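/- Let $J\ge 0$ be an integer, $\theta\in\mathbb R^J$ and let $R\in\mathbb R^{J\times J}$ be completely-$S$, i.e. for every principal submatrix $A$ of $R$ there is $x\ge 0$ with $Ax>0$ (componentwise). Write $\mathbb R_+=[0,\infty)$ and $\|x\|=\sum_i|x_i|$. A pair of continuous functions $Z,Y:\mathbb R_+\to\mathbb R_+^J$ solves the linear Skorokhod problem $\mathrm{LSP}(\theta,R)$ with initial state $Z_0\in\mathbb R_+^J$ if $Z(t)=Z_0+\theta t+RY(t)$ for all $t\ge0$, $Y(0)=0$, $Y$ is componentwise nondecreasing, and $\int_0^\infty Z_j(t)\,dY_j(t)=0$ for $j=1,\dots,J$. Let $\mathcal Q_{LSP}$ be the set of all $Z$ for which there are $Z_0$ and $Y$ such that $(Z,Y)$ solves $\mathrm{LSP}(\theta,R)$ with initial state $Z_0$. A nonempty set $\Phi$ of functions $Q:\mathbb R_+\to\mathbb R_+^K$ is a *closed GFN model* if (a) there is $L>0$ with $\|Q(t)-Q(s)\|\le L|t-s|$ for all $Q\in\Phi$ and $t,s\ge0$; (b) $\frac1rQ(r\,\cdot)\in\Phi$ for all $Q\in\Phi$, $r>0$;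 (c) $Q(s+\cdot)\in\Phi$ for all $Q\in\Phi$, $s\ge0$; (d) if $Q_n\in\Phi$ converge to $Q_*$ uniformly on compact sets, then $Q_*\in\Phi$. It has the *concatenation property* (e) if for all $Q_1,Q_2\in\Phi$ and $t^*\ge0$ with $Q_1(t^*)=Q_2(0)$ the function equal to $Q_1(t)$ for $t\le t^*$ and to $Q_2(t-t^*)$ for $t\ge t^*$ belongs to $\Phi$. It is *stable* if there is $\tau>0$ such that $Q(\tau+t)=0$ for all $t\ge0$ and all $Q\in\Phi$ with $\|Q(0)\|=1$. Let $\mathcal A(\Phi)=\{Q(0):Q\in\Phi\}$. A *Lyapunov function* for $\Phi$ is a function $V:\mathcal A(\Phi)\to\mathbb R_+$ for which there are continuous, strictly increasing $w_1,w_2,w_3:\mathbb R_+\to\mathbb R_+$ vanishing at $0$ such that $w_1(\|x\|)\le V(x)\le w_2(\|x\|)$ for all $x\in\mathcal A(\Phi)$ and $V(Q(t))-V(Q(s))\le-\int_s^t w_3(\|Q(r)\|)\,dr$ for all $Q\in\Phi$ and $0\le s\le t$. The problem $\mathrm{LSP}(\theta,R)$ is *stable* if for every $\varepsilon>0$ and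 every $Z\in\mathcal Q_{LSP}$ with $\|Z(0)\|=1$ there is $\tau\ge0$ such that $\|Z(\tau+t)\|<\varepsilon$ for all $t\ge0$. **Theorem.** $\mathcal Q_{LSP}$ is a closed GFN model with the concatenation property (e), and $\mathcal A(\mathcal Q_{LSP})=\mathbb R_+^J$. Moreover, $\mathrm{LSP}(\theta,R)$ is stable if and only if $\mathcal Q_{LSP}$ admits an upper semicontinuous Lyapunov function; and likewise the GFN model $\mathcal Q_{LSP}$ is stable if and only if it admits an upper semicontinuous Lyapunov function. -/

import Mathlib

open scoped NNReal ENNReal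
open MeasureTheory Filter

noncomputable section

/-! Time is `ℝ≥0` and the state space `ℝ₊ᴷ` is `Fin K → ℝ≥0`. -/

namespace GFN

/-- A path `Q : ℝ₊ → ℝ₊ᴷ`. -/
abbrev FluidPath (K : ℕ) : Type := ℝ≥0 → Fin K → ℝ≥0

/-- The norm `‖x‖ = ∑ |xᵢ|` of a vector of the nonnegative orthant. -/
def norm1 {K : ℕ} (x : Fin K → ℝ≥0) : ℝ≥0 := ∑ i, x i

/-- The distance `‖x - y‖ = ∑ |xᵢ - yᵢ|` of two vectors of the nonnegative orthant. -/
def dist1 {K : ℕ} (x y : Fin K → ℝ≥0) : ℝ := ∑ i, |(x i : ℝ) - (y i : ℝ)|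

/-- Uniform convergence on compact sets: uniform convergence on every interval `[0, T]`. -/
def TendstoUOC {K : ℕ} (Qn : ℕ → FluidPath K) (Q : FluidPath K) : Prop :=
  ∀ T : ℝ≥0, ∀ ε : ℝ, 0 < ε → ∃ N : ℕ, ∀ n, N ≤ n → ∀ t : ℝ≥0, t ≤ T → dist1 (Qn n t) (Q t) ≤ ε

/-- Generic fluid network (GFN) model: a nonempty set of paths with a common Lipschitz constant
that is invariant under scaling and under time shifts. -/
structure IsGFN {K : ℕ} (Φ : Set (FluidPath K)) : Prop where
  nonempty : Φ.Nonempty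
  lipschitz : ∃ L : ℝ, 0 < L ∧ ∀ Q ∈ Φ, ∀ t s : ℝ≥0, dist1 (Q t) (Q s) ≤ L * |(t : ℝ) - (s : ℝ)|
  scaling : ∀ Q ∈ Φ, ∀ r : ℝ≥0, 0 < r → (fun t i => r⁻¹ * Q (r * t) i) ∈ Φ
  shift : ∀ Q ∈ Φ, ∀ s : ℝ≥0, (fun t => Q (s + t)) ∈ Φ

/-- Closed GFN model: closed under u.o.c. convergence of sequences. -/
structure IsClosedGFN {K : ℕ} (Φ : Set (FluidPath K)) : Prop extends IsGFN Φ where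
  closed : ∀ (Qn : ℕ → FluidPath K) (Q : FluidPath K),
    (∀ n, Qn n ∈ Φ) → TendstoUOC Qn Q → Q ∈ Φ

/-- The concatenation of `Q₁` and `Q₂` at time `a`. -/
def concat {K : ℕ} (Q₁ Q₂ : FluidPath K) (a : ℝ≥0) : FluidPath K :=
  fun t => if t ≤ a then Q₁ t else Q₂ (t - a)

/-- The concatenation property. -/
def HasConcat {K : ℕ} (Φ : Set (FluidPath K)) : Prop :=
  ∀ Q₁ ∈ Φ, ∀ Q₂ ∈ Φ, ∀ a : ℝ≥0, Q₁ a = Q₂ 0 → concat Q₁ Q₂ a ∈ Φ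

/-- Stability of a GFN model: a common time after which all paths of initial level one vanish. -/
def IsStable {K : ℕ} (Φ : Set (FluidPath K)) : Prop :=
  ∃ τ : ℝ≥0, 0 < τ ∧ ∀ Q ∈ Φ, norm1 (Q 0) = 1 → ∀ t : ℝ≥0, Q (τ + t) = 0

/-- The set `𝒜(Φ)` of initial states of paths of `Φ`. -/
def initialStates {K : ℕ} (Φ : Set (FluidPath K)) : Set (Fin K → ℝ≥0) :=
  {x | ∃ Q ∈ Φ, Q 0 = x}

/-- Comparison functions of class `𝒦`. -/
structure ClassK (w : ℝ≥0 → ℝ≥0) : Prop where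
  continuous : Continuous w
  map_zero : w 0 = 0
  strictMono : StrictMono w

/-- `V` is a Lyapunov function for `Φ`. Only the values of `V` on `𝒜(Φ)` matter: by the shift
property, every state `Q t` of a path of a GFN model lies in `𝒜(Φ)`. -/
def IsLyapunov {K : ℕ} (Φ : Set (FluidPath K)) (V : (Fin K → ℝ≥0) → ℝ≥0) : Prop :=
  ∃ w₁ w₂ w₃ : ℝ≥0 → ℝ≥0, ClassK w₁ ∧ ClassK w₂ ∧ ClassK w₃ ∧
    (∀ x ∈ initialStates Φ, w₁ (norm1 x) ≤ V x ∧ V x ≤ w₂ (norm1 x)) ∧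
    ∀ Q ∈ Φ, ∀ s t : ℝ≥0, s ≤ t →
      (V (Q t) : ℝ) - (V (Q s) : ℝ) ≤
        -∫ r in (s : ℝ)..(t : ℝ), (w₃ (norm1 (Q r.toNNReal)) : ℝ)

/-- `Φ` admits a Lyapunov function that is upper semicontinuous on its domain `𝒜(Φ)`. -/
def AdmitsUSCLyapunov {K : ℕ} (Φ : Set (FluidPath K)) : Prop :=
  ∃ V : (Fin K → ℝ≥0) → ℝ≥0, IsLyapunov Φ V ∧ UpperSemicontinuousOn V (initialStates Φ)

end GFN

namespace LSP

/-- `A` is an `S`-matrix: `A x > 0` for some `x ≥ 0` (componentwise). -/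
def IsSMatrix {ι : Type} [Fintype ι] (A : Matrix ι ι ℝ) : Prop :=
  ∃ x : ι → ℝ, (∀ i, 0 ≤ x i) ∧ ∀ i, 0 < A.mulVec x i

/-- `R` is completely-`S`: every principal submatrix is an `S`-matrix. (The empty principal
submatrix is trivially an `S`-matrix.) -/
def IsCompletelyS {J : ℕ} (R : Matrix (Fin J) (Fin J) ℝ) : Prop :=
  ∀ s : Finset (Fin J), IsSMatrix (R.submatrix (fun i : s => (i : Fin J)) (fun i : s => (i : Fin J)))

/-- The `j`-th component of `Y`, extended to `ℝ` by its value at `0` on the negative reals. -/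
def component {J : ℕ} (Y : GFN.FluidPath J) (j : Fin J) : ℝ → ℝ := fun t => (Y t.toNNReal j : ℝ)

theorem component_mono {J : ℕ} {Y : GFN.FluidPath J} (hY : Monotone Y) (j : Fin J) :
    Monotone (component Y j) := fun _ _ hst =>
  NNReal.coe_le_coe.mpr (hY (Real.toNNReal_mono hst) j)

/-- The pair `(Z, Y)` solves the linear Skorokhod problem `LSP(θ, R)` with initial state `Z₀`. The
complementarity condition is `∫₀^∞ Z_j dY_j = 0`, an integral of a nonnegative function against the
Lebesgue–Stieltjes measure of `Y_j`. -/
structure IsSolution {J : ℕ} (θ : Fin J → ℝ) (R : Matrix (Fin J) (Fin J) ℝ)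
    (Z₀ : Fin J → ℝ≥0) (Z Y : GFN.FluidPath J) : Prop where
  continuous_Z : Continuous Z
  continuous_Y : Continuous Y
  equation : ∀ (t : ℝ≥0) (i : Fin J),
    (Z t i : ℝ) = (Z₀ i : ℝ) + θ i * (t : ℝ) + R.mulVec (fun j => (Y t j : ℝ)) i
  zero_Y : Y 0 = 0
  mono_Y : Monotone Y
  complementarity : ∀ j : Fin J,
    ∫⁻ t in Set.Ici (0 : ℝ), (Z t.toNNReal j : ℝ≥0∞)
      ∂((component_mono mono_Y j).stieltjesFunction.measure) = 0

/-- The set `𝒬_LSP` of all `Z`-parts of solutions of `LSP(θ, R)`, over all initial states. -/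
def solutionSet {J : ℕ} (θ : Fin J → ℝ) (R : Matrix (Fin J) (Fin J) ℝ) : Set (GFN.FluidPath J) :=
  {Z | ∃ (Z₀ : Fin J → ℝ≥0) (Y : GFN.FluidPath J), IsSolution θ R Z₀ Z Y}

/-- Stability of `LSP(θ, R)`: every path that starts at level one is eventually, and from then
on, smaller than any given `ε > 0`; the time may depend on the path. -/
def IsStable {J : ℕ} (θ : Fin J → ℝ) (R : Matrix (Fin J) (Fin J) ℝ) : Prop :=
  ∀ ε : ℝ, 0 < ε → ∀ Z ∈ solutionSet θ R, GFN.norm1 (Z 0) = 1 →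
    ∃ τ : ℝ≥0, ∀ t : ℝ≥0, (GFN.norm1 (Z (τ + t)) : ℝ) < ε

end LSP

end

/-!
The proof has three independent ingredients.

*Solutions of the Skorokhod problem.* For a continuous regulator `Y`, the complementarity
condition says that `Y_j` is constant on every interval on which `Z_j` is positive
(`LSP.IsSolution.apply_eq_of_pos`, `LSP.complementarity_of_forall`); in this form it is
stable under shifts, scalings, concatenations and limits. A completely-`S`
matrix is strictly semimonotone: a nonzero `y ≥ 0` has a coordinate with `y_i > 0` and
`(R y)_i > 0` (`LSP.IsCompletelyS.exists_pos_of_ne_zero`). Hence increments of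
`Y` are controlled by the levels of `Z` on the components that are active, and an induction on the
set of active components gives a common Lipschitz constant for all regulators
(`LSP.exists_sum_increment_le`). With Arzelà–Ascoli the set of solutions is closed. Existence
needs no complementarity problem to be solved: an Euler scheme that regulates every component of
level at most `δ` at a constant rate, given by an `S`-vector of the current face, has Lipschitz
regulators and is complementary up to an error of order `δ` (`LSP.IsCompletelyS.exists_euler`);
its limits are solutions (`LSP.exists_solution_of_approx`).

*From convergence to uniform extinction.* Let every path of level one of a closed GFN model with
concatenation converge to `0`. By compactness the level is halved within a common time, so by
scaling the level `0` is hit in a time proportional to the initial level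
(`GFN.IsClosedGFN.exists_hitting_time`). An excursion away from `0` could be repeated forever by
concatenation, contradicting convergence; so paths are absorbed at `0` and the model is stable
(`GFN.IsClosedGFN.isStable_of_isAttractive`).

*Lyapunov functions.* A Lyapunov function implies convergence of all paths
(`GFN.IsLyapunov.isAttractive`). Conversely, in a stable model the maximal total cost
`V(x) = sup ∫₀^∞ ‖Q(r)‖ dr` over paths from `x` is a Lyapunov function with `w₃(a) = a` and
quadratic `w₁`, `w₂`, and compactness makes it upper semicontinuous
(`GFN.IsClosedGFN.admitsUSCLyapunov`). Together these implications form a cycle through both notions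
of stability.
-/

namespace GFN

open Set Topology

/-! ### Paths, their norms and compactness -/

theorem dist1_self {K : ℕ} (x : Fin K → ℝ≥0) : dist1 x x = 0 := by simp [dist1]

theorem dist1_nonneg {K : ℕ} (x y : Fin K → ℝ≥0) : 0 ≤ dist1 x y :=
  Finset.sum_nonneg fun _ _ => abs_nonneg _

theorem dist_le_dist1 {K : ℕ} (x y : Fin K → ℝ≥0) : dist x y ≤ dist1 x y := by
  refine (dist_pi_le_iff (dist1_nonneg x y)).2 fun i => ?_
  rw [NNReal.dist_eq]
  exact Finset.single_le_sum (f := fun i => |(x i : ℝ) - (y i : ℝ)|)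
    (fun _ _ => abs_nonneg _) (Finset.mem_univ i)

theorem dist1_le_card_mul_dist {K : ℕ} (x y : Fin K → ℝ≥0) : dist1 x y ≤ K * dist x y := by
  have h : ∀ i ∈ (Finset.univ : Finset (Fin K)), |(x i : ℝ) - (y i : ℝ)| ≤ dist x y :=
    fun i _ => by rw [← NNReal.dist_eq]; exact dist_le_pi_dist x y i
  simpa [dist1] using Finset.sum_le_card_nsmul _ _ _ h

theorem coe_norm1 {K : ℕ} (x : Fin K → ℝ≥0) : (norm1 x : ℝ) = ∑ i, (x i : ℝ) := by
  simp [norm1]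

@[simp] theorem norm1_eq_zero {K : ℕ} {x : Fin K → ℝ≥0} : norm1 x = 0 ↔ x = 0 := by
  simp [norm1, Finset.sum_eq_zero_iff, funext_iff]

theorem norm1_smul {K : ℕ} (c : ℝ≥0) (x : Fin K → ℝ≥0) :
    norm1 (fun i => c * x i) = c * norm1 x := by
  simp [norm1, Finset.mul_sum]

theorem abs_norm1_sub_le {K : ℕ} (x y : Fin K → ℝ≥0) :
    |(norm1 x : ℝ) - norm1 y| ≤ dist1 x y := by
  rw [coe_norm1, coe_norm1, ← Finset.sum_sub_distrib]
  exact Finset.abs_sum_le_sum_abs _ _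

theorem continuous_norm1 {K : ℕ} : Continuous (norm1 : (Fin K → ℝ≥0) → ℝ≥0) := by
  unfold norm1; fun_prop

/-- Uniform convergence on compact sets implies pointwise convergence. -/
theorem TendstoUOC.tendsto {K : ℕ} {Qn : ℕ → FluidPath K} {Q : FluidPath K}
    (h : TendstoUOC Qn Q) (t : ℝ≥0) : Tendsto (fun n => Qn n t) atTop (𝓝 (Q t)) := by
  rw [Metric.tendsto_atTop]
  intro ε hε
  obtain ⟨N, hN⟩ := h t (ε / 2) (half_pos hε)
  exact ⟨N, fun n hn =>
    ((dist_le_dist1 _ _).trans (hN n hn t le_rfl)).trans_lt (half_lt_self hε)⟩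

theorem TendstoUOC.tendsto_coord {K : ℕ} {Qn : ℕ → FluidPath K} {Q : FluidPath K}
    (h : TendstoUOC Qn Q) (t : ℝ≥0) (i : Fin K) :
    Tendsto (fun n => (Qn n t i : ℝ)) atTop (𝓝 (Q t i : ℝ)) :=
  (NNReal.continuous_coe.tendsto _).comp ((tendsto_pi_nhds.1 (h.tendsto t)) i)

/-- A bound on the modulus of continuity in `dist1` gives Lipschitz continuity in the sup metric. -/
theorem lipschitzWith_of_dist1_le {K : ℕ} {Q : FluidPath K} {L : ℝ≥0}
    (h : ∀ t s : ℝ≥0, dist1 (Q t) (Q s) ≤ L * |(t : ℝ) - (s : ℝ)|) : LipschitzWith L Q :=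
  LipschitzWith.of_dist_le_mul fun t s => by
    rw [NNReal.dist_eq]; exact (dist_le_dist1 _ _).trans (h t s)

/-- Arzelà–Ascoli for Lipschitz maps on the half-line: those with a common Lipschitz constant and
bounded initial values form a compact set in the compact-open topology. -/
theorem isCompact_setOf_lipschitzWith {X : Type*} [MetricSpace X] [ProperSpace X] (L : ℝ≥0)
    (x₀ : X) (B : ℝ) :
    IsCompact {f : C(ℝ≥0, X) | LipschitzWith L f ∧ dist (f 0) x₀ ≤ B} := by
  apply ArzelaAscoli.isCompact_of_equicontinuous
  · have himage : ContinuousMap.toFun '' {f : C(ℝ≥0, X) | LipschitzWith L f ∧ dist (f 0) x₀ ≤ B}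
        = {f : ℝ≥0 → X | LipschitzWith L f ∧ dist (f 0) x₀ ≤ B} := by
      ext f
      constructor
      · rintro ⟨g, hg, rfl⟩
        exact hg
      · intro hf
        exact ⟨⟨f, hf.1.continuous⟩, hf, rfl⟩
    rw [himage]
    refine IsCompact.of_isClosed_subset
      (isCompact_univ_pi fun t : ℝ≥0 => isCompact_closedBall x₀ (L * t + B)) ?_ ?_
    · simp only [lipschitzWith_iff_dist_le_mul]
      rw [ofPred_and, ofPred_forall]
      refine IsClosed.inter (isClosed_iInter fun s => ?_)
        (isClosed_le (by fun_prop) continuous_const)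
      rw [ofPred_forall]
      exact isClosed_iInter fun t => isClosed_le (by fun_prop) continuous_const
    · intro f hf t _
      have h1 := hf.1.dist_le_mul t 0
      rw [NNReal.dist_eq, NNReal.coe_zero, sub_zero, NNReal.abs_eq] at h1
      exact (dist_triangle _ (f 0) _).trans (add_le_add h1 hf.2)
  · exact (LipschitzWith.uniformEquicontinuous _ L fun f => f.2.1).equicontinuous

/-- Equi-Lipschitz paths with bounded initial levels have a subsequence that converges uniformly
on compact sets. -/
theorem exists_subseq_tendstoUOC {K : ℕ} {Qn : ℕ → FluidPath K} {L : ℝ≥0}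
    (hL : ∀ n, LipschitzWith L (Qn n)) {B : ℝ} (hB : ∀ n, (norm1 (Qn n 0) : ℝ) ≤ B) :
    ∃ (Q : FluidPath K) (φ : ℕ → ℕ), StrictMono φ ∧ LipschitzWith L Q ∧
      TendstoUOC (Qn ∘ φ) Q := by
  let F : ℕ → C(ℝ≥0, Fin K → ℝ≥0) := fun n => ⟨Qn n, (hL n).continuous⟩
  have hF : ∀ n, F n ∈ {f : C(ℝ≥0, Fin K → ℝ≥0) | LipschitzWith L f ∧ dist (f 0) 0 ≤ B} := by
    refine fun n => ⟨hL n, (dist_le_dist1 _ _).trans ((le_of_eq ?_).trans (hB n))⟩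
    simp [dist1, coe_norm1, F]
  obtain ⟨f, hf, φ, hφ, hlim⟩ := (isCompact_setOf_lipschitzWith L 0 B).tendsto_subseq hF
  refine ⟨f, φ, hφ, hf.1, fun T ε hε => ?_⟩
  rw [ContinuousMap.tendsto_iff_forall_isCompact_tendstoUniformlyOn] at hlim
  have h := Metric.tendstoUniformlyOn_iff.1 (hlim (Icc 0 T) isCompact_Icc) (ε / (K + 1))
    (by positivity)
  obtain ⟨N, hN⟩ := eventually_atTop.1 h
  refine ⟨N, fun n hn t ht => (dist1_le_card_mul_dist _ _).trans ?_⟩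
  have h1 : dist (Qn (φ n) t) (f t) ≤ ε / (K + 1) := by
    rw [dist_comm]; exact (hN n hn t ⟨zero_le, ht⟩).le
  calc (K : ℝ) * dist (Qn (φ n) t) (f t) ≤ (K + 1) * (ε / (K + 1)) := by gcongr; linarith
    _ = ε := by field_simp

/-! ### Stability of closed GFN models with the concatenation property -/

variable {K : ℕ} {Φ : Set (FluidPath K)}

theorem IsGFN.exists_lipschitz (h : IsGFN Φ) : ∃ L : ℝ≥0, 0 < L ∧
    ∀ Q ∈ Φ, ∀ t s : ℝ≥0, dist1 (Q t) (Q s) ≤ L * |(t : ℝ) - (s : ℝ)| := by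
  obtain ⟨L, hL, H⟩ := h.lipschitz
  exact ⟨⟨L, hL.le⟩, hL, H⟩

theorem IsGFN.continuous (h : IsGFN Φ) {Q : FluidPath K} (hQ : Q ∈ Φ) : Continuous Q := by
  obtain ⟨L, -, H⟩ := h.exists_lipschitz
  exact (lipschitzWith_of_dist1_le (H Q hQ)).continuous

theorem IsGFN.continuous_norm1_comp (h : IsGFN Φ) {Q : FluidPath K} (hQ : Q ∈ Φ) :
    Continuous fun r : ℝ => norm1 (Q r.toNNReal) :=
  continuous_norm1.comp ((h.continuous hQ).comp continuous_real_toNNReal)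

theorem IsGFN.apply_mem_initialStates (h : IsGFN Φ) {Q : FluidPath K} (hQ : Q ∈ Φ) (t : ℝ≥0) :
    Q t ∈ initialStates Φ :=
  ⟨_, h.shift Q hQ t, by simp⟩

/-- Compactness: paths of a closed GFN model with bounded initial levels have a subsequence
converging to a path of the model. -/
theorem IsClosedGFN.exists_subseq_tendstoUOC (h : IsClosedGFN Φ) {Qn : ℕ → FluidPath K}
    (hQn : ∀ n, Qn n ∈ Φ) {B : ℝ} (hB : ∀ n, (norm1 (Qn n 0) : ℝ) ≤ B) :
    ∃ Q ∈ Φ, ∃ φ : ℕ → ℕ, StrictMono φ ∧ TendstoUOC (Qn ∘ φ) Q := by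
  obtain ⟨L, -, H⟩ := h.exists_lipschitz
  obtain ⟨Q, φ, hφ, -, hlim⟩ := GFN.exists_subseq_tendstoUOC
    (fun n => lipschitzWith_of_dist1_le (H _ (hQn n))) hB
  exact ⟨Q, h.closed _ Q (fun n => hQn (φ n)) hlim, φ, hφ, hlim⟩

/-- The stability notion of `LSP.IsStable` for an arbitrary set of paths: every path of initial
level one converges to `0`. -/
def IsAttractive (Φ : Set (FluidPath K)) : Prop :=
  ∀ ε : ℝ, 0 < ε → ∀ Q ∈ Φ, norm1 (Q 0) = 1 → ∃ τ : ℝ≥0, ∀ t : ℝ≥0, (norm1 (Q (τ + t)) : ℝ) < ε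

/-- A path shifted by `s` and rescaled by its level at time `s` is a path of initial level one. -/
theorem IsGFN.normalize (h : IsGFN Φ) {Q : FluidPath K} (hQ : Q ∈ Φ) (s : ℝ≥0)
    (hs : norm1 (Q s) ≠ 0) :
    ∃ P ∈ Φ, norm1 (P 0) = 1 ∧
      ∀ t, norm1 (Q (s + norm1 (Q s) * t)) = norm1 (Q s) * norm1 (P t) := by
  refine ⟨_, h.scaling _ (h.shift Q hQ s) (norm1 (Q s)) (pos_iff_ne_zero.2 hs), ?_, fun t => ?_⟩
  · simp [norm1_smul, hs]
  · simp [norm1_smul, hs]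

/-- By compactness, paths of initial level one halve their level within a common time. -/
theorem IsClosedGFN.exists_time_le_half (h : IsClosedGFN Φ) (ha : IsAttractive Φ) :
    ∃ T : ℝ≥0, ∀ Q ∈ Φ, norm1 (Q 0) = 1 → ∃ t ≤ T, norm1 (Q t) ≤ 2⁻¹ := by
  by_contra! hcon
  choose Qn hQn h0 hbig using fun n : ℕ => hcon n
  obtain ⟨Q, hQ, φ, hφ, hlim⟩ := h.exists_subseq_tendstoUOC hQn (B := 1) fun n => by simp [h0]
  have hnorm : ∀ t, Tendsto (fun n => norm1 (Qn (φ n) t)) atTop (𝓝 (norm1 (Q t))) := fun t =>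
    (continuous_norm1.tendsto _).comp (hlim.tendsto t)
  have hQ0 : norm1 (Q 0) = 1 := by
    refine tendsto_nhds_unique (hnorm 0) ?_
    simp [h0]
  obtain ⟨τ, hτ⟩ := ha 2⁻¹ (by norm_num) Q hQ hQ0
  have h1 := hτ 0
  have h2 : (2⁻¹ : ℝ≥0) ≤ norm1 (Q (τ + 0)) := by
    refine ge_of_tendsto (hnorm _) ?_
    obtain ⟨N, hN⟩ := exists_nat_ge (τ + 0)
    filter_upwards [eventually_ge_atTop N] with n hn
    refine (hbig (φ n) _ (hN.trans ?_)).le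
    exact_mod_cast hn.trans (hφ.id_le n)
  have h3 : ((2⁻¹ : ℝ≥0) : ℝ) ≤ norm1 (Q (τ + 0)) := NNReal.coe_le_coe.2 h2
  push_cast at h3
  linarith

/-- Halving the level repeatedly, at times that shrink geometrically, a path reaches `0` in a time
proportional to its initial level. -/
theorem IsClosedGFN.exists_hitting_time (h : IsClosedGFN Φ) (ha : IsAttractive Φ) :
    ∃ T : ℝ≥0, ∀ Q ∈ Φ, ∃ t ≤ T * norm1 (Q 0), Q t = 0 := by
  obtain ⟨T, hT⟩ := h.exists_time_le_half ha
  refine ⟨2 * T, fun Q hQ => ?_⟩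
  have hcont : Continuous fun t => t + 2 * T * norm1 (Q t) :=
    continuous_id.add (continuous_const.mul (continuous_norm1.comp (h.continuous hQ)))
  -- The last time at which the geometric budget is respected is a zero of the path.
  have hcomp : IsCompact {t : ℝ≥0 | t + 2 * T * norm1 (Q t) ≤ 2 * T * norm1 (Q 0)} :=
    (isCompact_Icc (a := (0 : ℝ≥0)) (b := 2 * T * norm1 (Q 0))).of_isClosed_subset
      (isClosed_le hcont continuous_const) fun t ht => ⟨zero_le, le_self_add.trans ht⟩
  obtain ⟨s, hs, hmax⟩ := hcomp.exists_isGreatest ⟨0, by simp⟩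
  refine ⟨s, le_self_add.trans hs, ?_⟩
  by_contra hne
  have hb : norm1 (Q s) ≠ 0 := fun h0 => hne (norm1_eq_zero.1 h0)
  obtain ⟨P, hP, hP0, hPt⟩ := h.normalize hQ s hb
  obtain ⟨u, huT, hu⟩ := hT P hP hP0
  have hmem : s + norm1 (Q s) * u ∈
      {t : ℝ≥0 | t + 2 * T * norm1 (Q t) ≤ 2 * T * norm1 (Q 0)} := by
    refine le_trans (b := s + 2 * T * norm1 (Q s)) ?_ hs
    rw [hPt]
    calc s + norm1 (Q s) * u + 2 * T * (norm1 (Q s) * norm1 (P u))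
        ≤ s + norm1 (Q s) * T + 2 * T * (norm1 (Q s) * 2⁻¹) := by gcongr
      _ = s + 2 * T * norm1 (Q s) := by
        rw [← NNReal.coe_inj]; push_cast; ring
  have hu0 : u = 0 := by
    have := hmax hmem
    have h2 : norm1 (Q s) * u ≤ 0 := by
      by_contra! h3
      exact absurd this (not_le.2 (lt_add_of_pos_right s h3))
    simpa [hb] using h2
  rw [hu0, hP0] at hu
  have : ((1 : ℝ≥0) : ℝ) ≤ (2⁻¹ : ℝ≥0) := NNReal.coe_le_coe.2 hu
  norm_num at this

/-- In an attractive model, paths that start at `0` stay there: an excursion from `0` returns to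
`0`, and its infinite repetition would be a path of the model that does not converge to `0`. -/
theorem IsClosedGFN.eq_zero_of_isAttractive (h : IsClosedGFN Φ) (hc : HasConcat Φ)
    (ha : IsAttractive Φ) {P : FluidPath K} (hP : P ∈ Φ) (hP0 : P 0 = 0) (t₀ : ℝ≥0) :
    P t₀ = 0 := by
  by_contra hne
  have hb : norm1 (P t₀) ≠ 0 := fun h0 => hne (norm1_eq_zero.1 h0)
  have ht₀ : 0 < t₀ := pos_iff_ne_zero.2 fun h0 => hne (h0 ▸ hP0)
  obtain ⟨T, hT⟩ := h.exists_hitting_time ha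
  obtain ⟨u, -, hu⟩ := hT _ (h.shift P hP t₀)
  set a := t₀ + u with ha_def
  let Qn : ℕ → FluidPath K := fun n => Nat.rec P (fun _ Q => concat P Q a) n
  have hQn : ∀ n, Qn n ∈ Φ ∧ Qn n 0 = 0 := by
    intro n
    induction n with
    | zero => exact ⟨hP, hP0⟩
    | succ n ih =>
      exact ⟨hc P hP _ ih.1 a (hu.trans ih.2.symm), by simp [Qn, concat, hP0]⟩
  have hval : ∀ k n : ℕ, k ≤ n → Qn n (k * a + t₀) = P t₀ := by
    intro k
    induction k with
    | zero =>
      intro n _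
      cases n with
      | zero => simp [Qn]
      | succ n => simp [Qn, concat, ha_def]
    | succ k ih =>
      intro n hn
      obtain ⟨m, rfl⟩ : ∃ m, n = m + 1 := ⟨n - 1, by omega⟩
      have h1 : ((k + 1 : ℕ) : ℝ≥0) * a + t₀ = (k * a + t₀) + a := by push_cast; ring
      have h2 : ¬ (k * a + t₀) + a ≤ a := not_le.2 (lt_add_of_pos_left a (by positivity))
      rw [h1, ← ih m (by omega)]
      change concat P (Qn m) a _ = _
      rw [concat, if_neg h2, add_tsub_cancel_right]
  obtain ⟨Q, hQ, φ, hφ, hlim⟩ := h.exists_subseq_tendstoUOC (fun n => (hQn n).1) (B := 0)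
    fun n => by rw [(hQn n).2, norm1_eq_zero.2 rfl, NNReal.coe_zero]
  have hQval : ∀ k : ℕ, Q (k * a + t₀) = P t₀ := fun k => by
    refine tendsto_nhds_unique (hlim.tendsto _) (tendsto_const_nhds.congr' ?_)
    filter_upwards [eventually_ge_atTop k] with n hn
    exact (hval k _ (hn.trans (hφ.id_le n))).symm
  have hQ0 : Q t₀ = P t₀ := by simpa using hQval 0
  obtain ⟨W, hW, hW0, hWt⟩ := h.normalize hQ t₀ (by rwa [hQ0])
  obtain ⟨τ, hτ⟩ := ha 1 one_pos W hW hW0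
  rw [hQ0] at hWt
  have hapos : 0 < a := ha_def ▸ ht₀.trans_le le_self_add
  obtain ⟨k, hk⟩ := exists_nat_ge (norm1 (P t₀) * τ / a)
  have hk' : norm1 (P t₀) * τ ≤ k * a := (div_le_iff₀ hapos).1 hk
  obtain ⟨v, hv⟩ := exists_add_of_le hk'
  have h1 := hWt (τ + (norm1 (P t₀))⁻¹ * v)
  have h2 : t₀ + norm1 (P t₀) * (τ + (norm1 (P t₀))⁻¹ * v) = k * a + t₀ := by
    rw [hv, mul_add, mul_inv_cancel_left₀ hb, add_comm]
  rw [h2, hQval] at h1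
  have h3 : norm1 (W (τ + (norm1 (P t₀))⁻¹ * v)) = 1 := by
    have := h1.symm
    rwa [mul_eq_left₀ hb] at this
  have := hτ ((norm1 (P t₀))⁻¹ * v)
  rw [h3] at this
  simp at this

theorem IsClosedGFN.isStable_of_isAttractive (h : IsClosedGFN Φ) (hc : HasConcat Φ)
    (ha : IsAttractive Φ) : IsStable Φ := by
  obtain ⟨T, hT⟩ := h.exists_hitting_time ha
  refine ⟨T + 1, by positivity, fun Q hQ hQ0 t => ?_⟩
  obtain ⟨s, hs, hs0⟩ := hT Q hQ
  rw [hQ0, mul_one] at hs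
  obtain ⟨v, hv⟩ := exists_add_of_le (hs.trans (le_self_add (b := 1 + t)))
  rw [add_assoc, hv]
  exact h.eq_zero_of_isAttractive hc ha (h.shift Q hQ s) (by simpa using hs0) v

/-- In a stable model a path vanishes after a time proportional to its initial level. For initial
level `0`, a path leaving `0` could be appended to a stable path that has reached `0`. -/
theorem IsGFN.exists_vanishing_time (h : IsGFN Φ) (hc : HasConcat Φ) (hs : IsStable Φ) :
    ∃ τ : ℝ≥0, 0 < τ ∧ ∀ Q ∈ Φ, ∀ t, τ * norm1 (Q 0) ≤ t → Q t = 0 := by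
  obtain ⟨τ, hτpos, hτ⟩ := hs
  refine ⟨τ, hτpos, fun Q hQ t ht => ?_⟩
  by_cases h0 : norm1 (Q 0) = 0
  · by_contra hne
    have hb : norm1 (Q t) ≠ 0 := fun h0 => hne (norm1_eq_zero.1 h0)
    obtain ⟨P, hP, hP0, -⟩ := h.normalize hQ t hb
    have hPτ : P τ = 0 := by simpa using hτ P hP hP0 0
    have hmem := hc P hP Q hQ τ (hPτ.trans (norm1_eq_zero.1 h0).symm)
    have h1 := hτ _ hmem (by simpa [concat] using hP0) t
    have ht0 : t ≠ 0 := by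
      rintro rfl
      exact hb h0
    rw [concat, if_neg (not_le.2 (lt_add_of_pos_right τ (pos_iff_ne_zero.2 ht0))),
      add_tsub_cancel_left] at h1
    exact hne h1
  · obtain ⟨P, hP, hP0, hPt⟩ := h.normalize hQ 0 h0
    obtain ⟨v, rfl⟩ := exists_add_of_le ht
    have h1 := hPt (τ + (norm1 (Q 0))⁻¹ * v)
    rw [norm1_eq_zero.2 (hτ P hP hP0 _), mul_zero, norm1_eq_zero, zero_add, mul_add,
      mul_inv_cancel_left₀ h0, mul_comm] at h1
    exact h1

/-! ### Lyapunov functions -/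

theorem classK_const_mul_sq {c : ℝ≥0} (hc : 0 < c) : ClassK fun a => c * a ^ 2 where
  continuous := by fun_prop
  map_zero := by simp
  strictMono := fun a b hab => by
    have : a ^ 2 < b ^ 2 := pow_lt_pow_left₀ hab zero_le two_ne_zero
    exact mul_lt_mul_of_pos_left this hc

theorem classK_id : ClassK fun a => a := ⟨continuous_id, rfl, strictMono_id⟩

/-- A Lyapunov function forces every path of initial level one to converge to `0`: the path must
enter every small level set of the norm, and it cannot leave larger ones afterwards. -/
theorem IsLyapunov.isAttractive (h : IsGFN Φ) {V : (Fin K → ℝ≥0) → ℝ≥0} (hV : IsLyapunov Φ V) :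
    IsAttractive Φ := by
  obtain ⟨w₁, w₂, w₃, hw₁, hw₂, hw₃, hbd, hdec⟩ := hV
  intro ε hε Q hQ hQ0
  have hw₁pos : 0 < w₁ ε.toNNReal := by
    simpa [hw₁.map_zero] using hw₁.strictMono (Real.toNNReal_pos.2 hε)
  obtain ⟨δ, hδ, hδpos⟩ : ∃ δ : ℝ≥0, w₂ δ < w₁ ε.toNNReal ∧ 0 < δ := by
    have h1 : ∀ᶠ δ in 𝓝[>] (0 : ℝ≥0), w₂ δ < w₁ ε.toNNReal :=
      (hw₂.continuous.tendsto 0).mono_left nhdsWithin_le_nhds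
        |>.eventually_lt_const (by rwa [hw₂.map_zero])
    exact (h1.and self_mem_nhdsWithin).exists
  have hcont : Continuous fun r : ℝ => (w₃ (norm1 (Q r.toNNReal)) : ℝ) :=
    NNReal.continuous_coe.comp (hw₃.continuous.comp (h.continuous_norm1_comp hQ))
  obtain ⟨τ, hτ⟩ : ∃ τ, norm1 (Q τ) ≤ δ := by
    by_contra! hcon
    have hw₃pos : 0 < w₃ δ := by simpa [hw₃.map_zero] using hw₃.strictMono hδpos
    obtain ⟨t, ht⟩ := exists_nat_gt ((V (Q 0) : ℝ) / w₃ δ)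
    have h1 := hdec Q hQ 0 (t : ℝ≥0) zero_le
    have h2 : ∫ _ in ((0 : ℝ≥0) : ℝ)..((t : ℝ≥0) : ℝ), (w₃ δ : ℝ) ≤
        ∫ r in ((0 : ℝ≥0) : ℝ)..((t : ℝ≥0) : ℝ), (w₃ (norm1 (Q r.toNNReal)) : ℝ) :=
      intervalIntegral.integral_mono_on (by simp) intervalIntegrable_const
        (hcont.intervalIntegrable _ _) fun r _ =>
          NNReal.coe_le_coe.2 (hw₃.strictMono.monotone (hcon _).le)
    rw [intervalIntegral.integral_const] at h2
    rw [div_lt_iff₀ (NNReal.coe_pos.2 hw₃pos)] at ht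
    have h3 : (0 : ℝ) ≤ V (Q (t : ℝ≥0)) := NNReal.coe_nonneg _
    simp only [NNReal.coe_natCast, NNReal.coe_zero, sub_zero, smul_eq_mul] at h1 h2 h3
    linarith
  refine ⟨τ, fun t => ?_⟩
  have h1 := hdec Q hQ τ (τ + t) le_self_add
  have h2 : 0 ≤ ∫ r in (τ : ℝ)..((τ + t : ℝ≥0) : ℝ), (w₃ (norm1 (Q r.toNNReal)) : ℝ) :=
    intervalIntegral.integral_nonneg (by simp) fun _ _ => NNReal.coe_nonneg _
  have h3 : V (Q (τ + t)) ≤ V (Q τ) := NNReal.coe_le_coe.1 (by linarith)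
  have h4 : w₁ (norm1 (Q (τ + t))) < w₁ ε.toNNReal :=
    calc w₁ (norm1 (Q (τ + t))) ≤ V (Q (τ + t)) := (hbd _ (h.apply_mem_initialStates hQ _)).1
      _ ≤ V (Q τ) := h3
      _ ≤ w₂ (norm1 (Q τ)) := (hbd _ (h.apply_mem_initialStates hQ _)).2
      _ ≤ w₂ δ := hw₂.strictMono.monotone hτ
      _ < w₁ ε.toNNReal := hδ
  have h5 := NNReal.coe_lt_coe.2 (hw₁.strictMono.lt_iff_lt.1 h4)
  rwa [Real.coe_toNNReal _ hε.le] at h5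

/-- The cost `∫₀ᵀ ‖Q(r)‖ dr` of a path up to time `T`. -/
noncomputable def cost (Q : FluidPath K) (T : ℝ≥0) : ℝ :=
  ∫ r in (0 : ℝ)..(T : ℝ), (norm1 (Q r.toNNReal) : ℝ)

/-- The costs, up to arbitrary times, of the paths of `Φ` that start at `x`. -/
def costs (Φ : Set (FluidPath K)) (x : Fin K → ℝ≥0) : Set ℝ :=
  {c | ∃ Q ∈ Φ, Q 0 = x ∧ ∃ T, cost Q T = c}

/-- The maximal total cost `V(x) = sup {∫₀^∞ ‖Q(r)‖ dr : Q ∈ Φ, Q(0) = x}`. The supremum over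
finite horizons equals the supremum of the integrals over the half-line. -/
noncomputable def maxCost (Φ : Set (FluidPath K)) (x : Fin K → ℝ≥0) : ℝ≥0 :=
  (sSup (costs Φ x)).toNNReal

theorem cost_nonneg (Q : FluidPath K) (T : ℝ≥0) : 0 ≤ cost Q T :=
  intervalIntegral.integral_nonneg T.2 fun _ _ => NNReal.coe_nonneg _

theorem IsGFN.intervalIntegrable_norm1 (h : IsGFN Φ) {Q : FluidPath K} (hQ : Q ∈ Φ) (a b : ℝ) :
    IntervalIntegrable (fun r : ℝ => (norm1 (Q r.toNNReal) : ℝ)) volume a b :=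
  (NNReal.continuous_coe.comp (h.continuous_norm1_comp hQ)).intervalIntegrable a b

theorem IsGFN.cost_sub_cost (h : IsGFN Φ) {Q : FluidPath K} (hQ : Q ∈ Φ) (s t : ℝ≥0) :
    cost Q t - cost Q s = ∫ r in (s : ℝ)..(t : ℝ), (norm1 (Q r.toNNReal) : ℝ) :=
  intervalIntegral.integral_interval_sub_left (h.intervalIntegrable_norm1 hQ _ _)
    (h.intervalIntegrable_norm1 hQ _ _)

theorem IsGFN.cost_mono (h : IsGFN Φ) {Q : FluidPath K} (hQ : Q ∈ Φ) : Monotone (cost Q) := by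
  intro s t hst
  rw [← sub_nonneg, h.cost_sub_cost hQ]
  exact intervalIntegral.integral_nonneg hst fun _ _ => NNReal.coe_nonneg _

/-- The cost of a path does not increase once the path has vanished. -/
theorem IsGFN.cost_le_of_vanishing (h : IsGFN Φ) {Q : FluidPath K} (hQ : Q ∈ Φ) {s : ℝ≥0}
    (hs : ∀ t, s ≤ t → Q t = 0) (t : ℝ≥0) : cost Q t ≤ cost Q s := by
  rcases le_total t s with hts | hst
  · exact h.cost_mono hQ hts
  · rw [← sub_nonpos, h.cost_sub_cost hQ]
    refine (intervalIntegral.integral_zero_ae (Eventually.of_forall fun r hr => ?_)).le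
    rw [uIoc_of_le (NNReal.coe_le_coe.2 hst)] at hr
    rw [hs _ (NNReal.le_toNNReal_of_coe_le hr.1.le), norm1_eq_zero.2 rfl, NNReal.coe_zero]

/-- The cost of a path followed from time `s` on and continued at time `s + u` by another path. -/
theorem IsGFN.cost_concat_shift (h : IsGFN Φ) {Q P : FluidPath K}
    (s u T : ℝ≥0) (hcont : Q (s + u) = P 0)
    (hmem : concat (fun t => Q (s + t)) P u ∈ Φ) :
    cost (concat (fun t => Q (s + t)) P u) (u + T) =
      (∫ r in (s : ℝ)..((s + u : ℝ≥0) : ℝ), (norm1 (Q r.toNNReal) : ℝ)) + cost P T := by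
  have h1 := h.cost_sub_cost hmem u (u + T)
  have h2 : cost (concat (fun t => Q (s + t)) P u) u =
      ∫ r in (s : ℝ)..((s + u : ℝ≥0) : ℝ), (norm1 (Q r.toNNReal) : ℝ) := by
    rw [cost, NNReal.coe_add]
    have h3 := intervalIntegral.integral_comp_add_left (a := 0) (b := (u : ℝ))
      (fun r : ℝ => (norm1 (Q r.toNNReal) : ℝ)) (s : ℝ)
    rw [add_zero] at h3
    rw [← h3]
    refine intervalIntegral.integral_congr fun r hr => ?_
    rw [uIcc_of_le (NNReal.coe_nonneg u)] at hr
    have hr' : r.toNNReal ≤ u := Real.toNNReal_le_iff_le_coe.2 hr.2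
    simp only [concat, if_pos hr']
    rw [Real.toNNReal_add (NNReal.coe_nonneg s) hr.1, Real.toNNReal_coe]
  have h4 : ∫ r in (u : ℝ)..((u + T : ℝ≥0) : ℝ),
      (norm1 (concat (fun t => Q (s + t)) P u r.toNNReal) : ℝ) = cost P T := by
    rw [NNReal.coe_add, cost]
    have h3 := intervalIntegral.integral_comp_add_left (a := 0) (b := (T : ℝ))
      (fun r : ℝ => (norm1 (concat (fun t => Q (s + t)) P u r.toNNReal) : ℝ)) (u : ℝ)
    rw [add_zero] at h3
    rw [← h3]
    refine intervalIntegral.integral_congr fun r hr => ?_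
    rw [uIcc_of_le (NNReal.coe_nonneg T)] at hr
    rw [Real.toNNReal_add (NNReal.coe_nonneg u) hr.1, Real.toNNReal_coe, concat]
    split_ifs with hle
    · have hr0 : r.toNNReal = 0 := by
        by_contra hne
        exact absurd hle (not_le.2 (lt_add_of_pos_right u (pos_iff_ne_zero.2 hne)))
      rw [hr0, add_zero, hcont]
    · rw [add_tsub_cancel_left]
  rw [h4, h2] at h1
  linarith

/-- On a fixed horizon the cost is continuous along convergent sequences of paths. -/
theorem IsGFN.tendsto_cost (h : IsGFN Φ) {Qn : ℕ → FluidPath K} {Q : FluidPath K}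
    (hQn : ∀ n, Qn n ∈ Φ) (hQ : Q ∈ Φ) (hlim : TendstoUOC Qn Q) (T : ℝ≥0) :
    Tendsto (fun n => cost (Qn n) T) atTop (𝓝 (cost Q T)) := by
  rw [Metric.tendsto_atTop]
  intro ε hε
  obtain ⟨N, hN⟩ := hlim T (ε / (T + 1)) (by positivity)
  refine ⟨N, fun n hn => ?_⟩
  rw [Real.dist_eq, cost, cost, ← intervalIntegral.integral_sub
    (h.intervalIntegrable_norm1 (hQn n) _ _) (h.intervalIntegrable_norm1 hQ _ _)]
  have h1 := intervalIntegral.norm_integral_le_of_norm_le_const (a := 0) (b := (T : ℝ))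
    (C := ε / (T + 1))
    (f := fun r : ℝ => (norm1 (Qn n r.toNNReal) : ℝ) - norm1 (Q r.toNNReal)) fun r hr => by
      rw [uIoc_of_le (NNReal.coe_nonneg T)] at hr
      exact (abs_norm1_sub_le _ _).trans
        (hN n hn _ (Real.toNNReal_le_iff_le_coe.2 hr.2))
  rw [sub_zero, NNReal.abs_eq, Real.norm_eq_abs] at h1
  refine h1.trans_lt ?_
  rw [div_mul_eq_mul_div, div_lt_iff₀ (by positivity)]
  nlinarith [T.2]

/-- **Converse Lyapunov theorem**: the maximal total cost is an upper semicontinuous Lyapunov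
function of a stable closed GFN model with the concatenation property. It decreases along paths by
dynamic programming (concatenation), and it is upper semicontinuous because near-optimal paths
accumulate (compactness). -/
theorem IsClosedGFN.admitsUSCLyapunov (h : IsClosedGFN Φ) (hc : HasConcat Φ) (hs : IsStable Φ) :
    AdmitsUSCLyapunov Φ := by
  obtain ⟨L, hL, hlip⟩ := h.exists_lipschitz
  obtain ⟨τ, hτ, hvan⟩ := h.exists_vanishing_time hc hs
  have hdiff : ∀ Q ∈ Φ, ∀ t : ℝ≥0, |(norm1 (Q t) : ℝ) - norm1 (Q 0)| ≤ L * t := fun Q hQ t => by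
    simpa using (abs_norm1_sub_le _ _).trans (hlip Q hQ t 0)
  have hcost : ∀ Q ∈ Φ, ∀ t, cost Q t ≤ τ * (1 + L * τ) * (norm1 (Q 0) : ℝ) ^ 2 := by
    intro Q hQ t
    refine (h.cost_le_of_vanishing hQ (hvan Q hQ) t).trans ?_
    have h1 : cost Q (τ * norm1 (Q 0)) ≤
        ∫ _ in (0 : ℝ)..((τ * norm1 (Q 0) : ℝ≥0) : ℝ), (1 + L * τ) * (norm1 (Q 0) : ℝ) := by
      refine intervalIntegral.integral_mono_on (NNReal.coe_nonneg _)
        (h.intervalIntegrable_norm1 hQ _ _) intervalIntegrable_const fun r hr => ?_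
      have h2 := (abs_le.1 (hdiff Q hQ r.toNNReal)).2
      have h3 : (L : ℝ) * r.toNNReal ≤ L * (τ * norm1 (Q 0)) := by
        rw [Real.coe_toNNReal _ hr.1]
        exact mul_le_mul_of_nonneg_left (by simpa using hr.2) L.2
      linarith
    rw [intervalIntegral.integral_const] at h1
    simp only [sub_zero, smul_eq_mul, NNReal.coe_mul] at h1
    refine h1.trans (le_of_eq ?_)
    ring
  have hbdd : ∀ x, BddAbove (costs Φ x) := by
    refine fun x => ⟨τ * (1 + L * τ) * (norm1 x : ℝ) ^ 2, ?_⟩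
    rintro c ⟨Q, hQ, rfl, T, rfl⟩
    exact hcost Q hQ T
  have hle : ∀ Q ∈ Φ, ∀ T, cost Q T ≤ maxCost Φ (Q 0) := fun Q hQ T =>
    (le_csSup (hbdd _) ⟨Q, hQ, rfl, T, rfl⟩).trans (Real.le_coe_toNNReal _)
  have hmax_le : ∀ x (B : ℝ), 0 ≤ B → (∀ Q ∈ Φ, Q 0 = x → ∀ T, cost Q T ≤ B) →
      (maxCost Φ x : ℝ) ≤ B := by
    intro x B hB H
    rw [maxCost, Real.coe_toNNReal', max_le_iff]
    refine ⟨Real.sSup_le ?_ hB, hB⟩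
    rintro c ⟨Q, hQ, hQ0, T, rfl⟩
    exact H Q hQ hQ0 T
  refine ⟨maxCost Φ, ⟨fun a => (4 * L)⁻¹ * a ^ 2, fun a => (τ * (1 + L * τ)) * a ^ 2, fun a => a,
    classK_const_mul_sq (by positivity), classK_const_mul_sq (by positivity), classK_id,
    ?_, ?_⟩, ?_⟩
  · rintro x ⟨Q, hQ, rfl⟩
    refine ⟨?_, ?_⟩
    · -- Up to time `‖x‖ / (2L)` the level stays above `‖x‖ / 2`.
      rw [← NNReal.coe_le_coe]
      refine le_trans ?_ (hle Q hQ (norm1 (Q 0) / (2 * L)))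
      have h1 : ∫ _ in (0 : ℝ)..((norm1 (Q 0) / (2 * L) : ℝ≥0) : ℝ), (norm1 (Q 0) : ℝ) / 2 ≤
          cost Q (norm1 (Q 0) / (2 * L)) := by
        refine intervalIntegral.integral_mono_on (NNReal.coe_nonneg _)
          intervalIntegrable_const (h.intervalIntegrable_norm1 hQ _ _) fun r hr => ?_
        have h2 := (abs_le.1 (hdiff Q hQ r.toNNReal)).1
        have h3 : (L : ℝ) * r.toNNReal ≤ norm1 (Q 0) / 2 := by
          rw [Real.coe_toNNReal _ hr.1]
          have h4 := hr.2
          push_cast at h4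
          rw [le_div_iff₀ (by positivity)] at h4
          linarith
        linarith
      rw [intervalIntegral.integral_const] at h1
      refine le_trans (le_of_eq ?_) h1
      have hL' : (L : ℝ) ≠ 0 := (NNReal.coe_pos.2 hL).ne'
      push_cast
      simp only [sub_zero, smul_eq_mul]
      field_simp
      ring
    · rw [← NNReal.coe_le_coe]
      refine hmax_le _ _ (NNReal.coe_nonneg _) fun P hP hP0 T => ?_
      rw [← hP0]
      simpa using hcost P hP T
  · intro Q hQ s t hst
    obtain ⟨u, rfl⟩ := exists_add_of_le hst
    have hkey : (maxCost Φ (Q (s + u)) : ℝ) ≤ maxCost Φ (Q s) -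
        ∫ r in (s : ℝ)..((s + u : ℝ≥0) : ℝ), (norm1 (Q r.toNNReal) : ℝ) := by
      have hstep : ∀ P ∈ Φ, P 0 = Q (s + u) → ∀ T, cost P T ≤ maxCost Φ (Q s) -
          ∫ r in (s : ℝ)..((s + u : ℝ≥0) : ℝ), (norm1 (Q r.toNNReal) : ℝ) := by
        intro P hP hP0 T
        have hmem := hc _ (h.shift Q hQ s) P hP u hP0.symm
        have h1 := hle _ hmem (u + T)
        rw [h.cost_concat_shift s u T hP0.symm hmem] at h1
        have h2 : concat (fun t => Q (s + t)) P u 0 = Q s := by simp [concat]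
        rw [h2] at h1
        linarith
      refine hmax_le _ _ ?_ hstep
      exact (cost_nonneg _ 0).trans (hstep _ (h.shift Q hQ (s + u)) (by simp) 0)
    linarith
  · intro x hx y hy
    by_contra hcon
    rw [not_eventually] at hcon
    obtain ⟨xn, hxn, hfreq⟩ := exists_seq_forall_of_frequently hcon
    obtain ⟨z, hz, hzy⟩ := exists_between hy
    have hxn' : Tendsto xn atTop (𝓝 x) := hxn.mono_right nhdsWithin_le_nhds
    have hex : ∀ n, ∃ Q ∈ Φ, Q 0 = xn n ∧ ∃ T, (z : ℝ) < cost Q T := by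
      intro n
      by_contra! hall
      have := NNReal.coe_le_coe.1 (hmax_le (xn n) z z.2 hall)
      exact hfreq n (this.trans_lt hzy)
    choose Qn hQn hQn0 Tn hTn using hex
    have hbd : ∀ᶠ n in atTop, norm1 (xn n) < norm1 x + 1 :=
      ((continuous_norm1.tendsto x).comp hxn').eventually_lt_const (lt_add_one _)
    obtain ⟨N, hN⟩ := eventually_atTop.1 hbd
    obtain ⟨Q, hQ, φ, hφ, hlim⟩ := h.exists_subseq_tendstoUOC
      (Qn := fun n => Qn (n + N)) (fun n => hQn _) (B := norm1 x + 1) fun n => by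
        rw [hQn0]
        exact_mod_cast (hN (n + N) (Nat.le_add_left _ _)).le
    have hQ0 : Q 0 = x := by
      refine tendsto_nhds_unique (hlim.tendsto 0) ?_
      simp only [Function.comp_def, hQn0]
      exact hxn'.comp ((tendsto_add_atTop_nat N).comp hφ.tendsto_atTop)
    -- All the paths vanish by the same time, so one horizon captures the total costs.
    have hz' : (z : ℝ) ≤ cost Q (τ * (norm1 x + 1)) := by
      refine ge_of_tendsto' (h.tendsto_cost (fun n => hQn _) hQ hlim _) fun n => ?_
      refine (hTn _).le.trans (h.cost_le_of_vanishing (hQn _) (fun t ht => ?_) _)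
      refine hvan _ (hQn _) t (le_trans ?_ ht)
      rw [hQn0]
      exact mul_le_mul_right (hN _ (Nat.le_add_left _ _)).le _
    have h1 := hz'.trans (hle Q hQ _)
    rw [hQ0] at h1
    exact absurd hz (not_lt.2 (NNReal.coe_le_coe.1 h1))

end GFN

namespace LSP

open Set Topology GFN

/-! ### The complementarity condition -/

variable {J : ℕ} {θ : Fin J → ℝ} {R : Matrix (Fin J) (Fin J) ℝ}

theorem continuous_component {Y : FluidPath J} (hY : Continuous Y) (j : Fin J) :
    Continuous (component Y j) :=
  NNReal.continuous_coe.comp ((continuous_apply j).comp (hY.comp continuous_real_toNNReal))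

theorem measure_Ioo_component {Y : FluidPath J} (hY : Monotone Y) (hc : Continuous Y) (j : Fin J)
    (a b : ℝ) : (component_mono hY j).stieltjesFunction.measure (Ioo a b) =
      ENNReal.ofReal (component Y j b - component Y j a) := by
  have hS : ∀ x, (component_mono hY j).stieltjesFunction x = component Y j x := fun x => by
    rw [Monotone.stieltjesFunction_eq]
    exact (continuous_component hc j).continuousWithinAt.rightLim_eq
  have hS' : ⇑(component_mono hY j).stieltjesFunction = component Y j := funext hS
  rw [StieltjesFunction.measure_Ioo, hS']
  rw [(continuous_component hc j).continuousWithinAt.leftLim_eq]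

/-- `Y_j` does not increase on open time intervals on which `Z_j` is positive. -/
theorem IsSolution.apply_eq_of_pos {Z₀ : Fin J → ℝ≥0} {Z Y : FluidPath J}
    (h : IsSolution θ R Z₀ Z Y) {j : Fin J} {s t : ℝ≥0} (hst : s ≤ t)
    (hpos : ∀ u, s < u → u < t → 0 < Z u j) : Y s j = Y t j := by
  have hmeas : Measurable fun t : ℝ => (Z t.toNNReal j : ℝ≥0∞) :=
    (ENNReal.continuous_coe.comp ((continuous_apply j).comp
      (h.continuous_Z.comp continuous_real_toNNReal))).measurable
  have h0 := h.complementarity j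
  rw [lintegral_eq_zero_iff hmeas, EventuallyEq, ae_iff,
    Measure.restrict_apply' measurableSet_Ici] at h0
  have hsub : Ioo (s : ℝ) t ⊆
      {u : ℝ | ¬ (Z u.toNNReal j : ℝ≥0∞) = (0 : ℝ → ℝ≥0∞) u} ∩ Ici (0 : ℝ) := by
    intro u hu
    have hu0 : 0 ≤ u := s.2.trans hu.1.le
    refine ⟨?_, hu0⟩
    lift u to ℝ≥0 using hu0
    have := hpos u (NNReal.coe_lt_coe.1 hu.1) (NNReal.coe_lt_coe.1 hu.2)
    simpa using this.ne'
  have h1 := measure_mono_null hsub h0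
  rw [measure_Ioo_component h.mono_Y h.continuous_Y, ENNReal.ofReal_eq_zero, sub_nonpos] at h1
  refine le_antisymm (h.mono_Y hst j) ?_
  simpa [component] using h1

/-- A pathwise form of the complementarity condition that is sufficient for it. -/
theorem complementarity_of_forall {Z Y : FluidPath J} (hZ : Continuous Z) (hYc : Continuous Y)
    (hY : Monotone Y) (j : Fin J)
    (hcomp : ∀ s t : ℝ≥0, s ≤ t → (∀ u ∈ Icc s t, 0 < Z u j) → Y s j = Y t j) :
    ∫⁻ t in Ici (0 : ℝ), (Z t.toNNReal j : ℝ≥0∞)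
      ∂((component_mono hY j).stieltjesFunction.measure) = 0 := by
  have hZc : Continuous fun t : ℝ => Z t.toNNReal j :=
    (continuous_apply j).comp (hZ.comp continuous_real_toNNReal)
  have hmeas : Measurable fun t : ℝ => (Z t.toNNReal j : ℝ≥0∞) :=
    (ENNReal.continuous_coe.comp hZc).measurable
  rw [lintegral_eq_zero_iff hmeas, EventuallyEq, ae_restrict_iff' measurableSet_Ici, ae_iff]
  refine measure_null_of_locally_null _ fun x hx => ?_
  have hx0 : 0 ≤ x ∧ Z x.toNNReal j ≠ 0 := by simpa using hx
  have hx' : 0 < Z x.toNNReal j := pos_iff_ne_zero.2 hx0.2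
  obtain ⟨ε, hε, hball⟩ := Metric.eventually_nhds_iff_ball.1
    (hZc.continuousAt.eventually_const_lt hx')
  refine ⟨Ioo (x - ε / 2) (x + ε / 2),
    mem_nhdsWithin_of_mem_nhds (Ioo_mem_nhds (by linarith) (by linarith)), ?_⟩
  rw [measure_Ioo_component hY hYc, ENNReal.ofReal_eq_zero, sub_nonpos]
  refine (NNReal.coe_le_coe.2 (hcomp _ _ (Real.toNNReal_mono (by linarith)) ?_).ge)
  intro u hu
  -- A time in the truncated interval is the truncation of a time in the interval.
  obtain ⟨v, hv, rfl⟩ : ∃ v ∈ Icc (x - ε / 2) (x + ε / 2), v.toNNReal = u := by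
    refine ⟨max u (x - ε / 2), ⟨le_max_right _ _, max_le ?_ (by linarith)⟩, ?_⟩
    · rw [← Real.coe_toNNReal (x + ε / 2) (by linarith [hx0.1])]
      exact NNReal.coe_le_coe.2 hu.2
    · have hm : Monotone Real.toNNReal := fun _ _ => Real.toNNReal_le_toNNReal
      rw [hm.map_max, Real.toNNReal_coe, max_eq_left hu.1]
  refine hball v ?_
  rw [Real.ball_eq_Ioo]
  exact ⟨by linarith [hv.1], by linarith [hv.2]⟩

/-! ### Completely-`S` matrices -/

/-- The `S`-property of the principal submatrix indexed by `I`, with a witness in the full space. -/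
theorem IsCompletelyS.exists_mulVec_pos (hR : IsCompletelyS R) (I : Finset (Fin J)) :
    ∃ x : Fin J → ℝ, (∀ j, 0 ≤ x j) ∧ (∀ j ∉ I, x j = 0) ∧ ∀ i ∈ I, 0 < R.mulVec x i := by
  obtain ⟨x, hx0, hx⟩ := hR I
  refine ⟨fun j => if h : j ∈ I then x ⟨j, h⟩ else 0, fun j => ?_, fun j hj => dif_neg hj,
    fun i hi => ?_⟩
  · dsimp only
    split_ifs with h
    · exact hx0 _
    · exact le_rfl
  · refine (hx ⟨i, hi⟩).trans_le (le_of_eq ?_)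
    simp only [Matrix.mulVec, dotProduct, Matrix.submatrix_apply]
    rw [← Finset.sum_subset (Finset.subset_univ I)
      (fun j _ hj => by rw [dif_neg hj, mul_zero]), ← Finset.sum_attach I]
    refine Finset.sum_congr rfl fun j _ => ?_
    rw [dif_pos j.2]

/-- A completely-`S` matrix is strictly semimonotone. Subtracting from a counterexample `y` the
largest admissible multiple of an `S`-vector of its support gives a counterexample of smaller
support. -/
theorem IsCompletelyS.exists_pos_of_ne_zero (hR : IsCompletelyS R) {y : Fin J → ℝ}
    (hy : ∀ j, 0 ≤ y j) (hne : y ≠ 0) : ∃ i, 0 < y i ∧ 0 < R.mulVec y i := by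
  induction hn : (Finset.univ.filter fun j => 0 < y j).card using Nat.strong_induction_on
    generalizing y with
  | _ n ih =>
    by_contra! hcon
    obtain ⟨x, hx0, hxI, hx⟩ := hR.exists_mulVec_pos (Finset.univ.filter fun j => 0 < y j)
    simp only [Finset.mem_filter, Finset.mem_univ, true_and] at hxI hx
    obtain ⟨i₀, hi₀⟩ : ∃ i, 0 < y i := by
      by_contra! h
      exact hne (funext fun j => le_antisymm (h j) (hy j))
    obtain ⟨j₀, hj₀⟩ : ∃ j, 0 < x j := by
      by_contra! h
      have hxz : x = 0 := funext fun j => le_antisymm (h j) (hx0 j)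
      simpa [hxz] using hx i₀ hi₀
    obtain ⟨k, hk, hmin⟩ := Finset.exists_min_image (Finset.univ.filter fun j => 0 < x j)
      (fun j => y j / x j) ⟨j₀, by simpa using hj₀⟩
    simp only [Finset.mem_filter, Finset.mem_univ, true_and] at hk hmin
    have hyk : 0 < y k := by
      by_contra h
      exact hk.ne' (hxI k h)
    have hc : 0 < y k / x k := div_pos hyk hk
    set c := y k / x k
    have hR' : ∀ i, R.mulVec (y - c • x) i = R.mulVec y i - c * R.mulVec x i := fun i => by
      rw [Matrix.mulVec_sub, Matrix.mulVec_smul]; rfl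
    have hneg : ∀ i, 0 < y i → R.mulVec (y - c • x) i < 0 := fun i hi => by
      rw [hR']
      have := mul_pos hc (hx i hi)
      linarith [hcon i hi]
    have hy' : ∀ j, 0 ≤ (y - c • x) j := fun j => by
      rcases (hx0 j).eq_or_lt with h | h
      · simpa [← h] using hy j
      · simpa using (le_div_iff₀ h).1 (hmin j h)
    have hsupp : ∀ j, 0 < (y - c • x) j → 0 < y j := fun j hj => by
      have h1 : 0 < y j - c * x j := hj
      linarith [mul_nonneg hc.le (hx0 j)]
    have hne' : y - c • x ≠ 0 := fun h0 => by simpa [h0] using hneg i₀ hi₀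
    have hlt : (Finset.univ.filter fun j => 0 < (y - c • x) j).card < n := by
      rw [← hn]
      refine Finset.card_lt_card (Finset.ssubset_iff_of_subset (fun j hj => ?_) |>.2 ⟨k, ?_, ?_⟩)
      · simpa using hsupp j (by simpa using hj)
      · simpa using hyk
      · simp [c, hk.ne']
    obtain ⟨i, hi, hi'⟩ := ih _ hlt hy' hne' rfl
    exact lt_asymm hi' (hneg i (hsupp i hi))

/-- The quantitative form of strict semimonotonicity on the face of vectors supported in `I`. -/
theorem IsCompletelyS.exists_mul_sum_le (hR : IsCompletelyS R) (I : Finset (Fin J)) :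
    ∃ ε : ℝ, 0 < ε ∧ ∀ (y : Fin J → ℝ) (b : ℝ), (∀ j, 0 ≤ y j) → (∀ j ∉ I, y j = 0) → 0 ≤ b →
      (∀ i ∈ I, R.mulVec y i ≤ b) → ε * ∑ j, y j ≤ b := by
  rcases I.eq_empty_or_nonempty with rfl | hI
  · refine ⟨1, one_pos, fun y b _ hy hb _ => ?_⟩
    rw [Finset.sum_eq_zero fun j _ => hy j (Finset.notMem_empty j), mul_zero]
    exact hb
  have hcomp : IsCompact {y ∈ stdSimplex ℝ (Fin J) | ∀ j ∉ I, y j = 0} := by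
    have hclosed : IsClosed {y : Fin J → ℝ | ∀ j ∉ I, y j = 0} := by
      simp only [ofPred_forall]
      exact isClosed_iInter fun j => isClosed_iInter fun _ =>
        isClosed_eq (continuous_apply j) continuous_const
    exact (isCompact_stdSimplex ℝ (Fin J)).inter_right hclosed
  have hcont : Continuous fun y : Fin J → ℝ => I.sup' hI fun i => R.mulVec y i :=
    Continuous.finset_sup'_apply hI fun i _ =>
      (continuous_apply i).comp (Continuous.matrix_mulVec continuous_const continuous_id)
  obtain ⟨ε, hε, hmin⟩ := hcomp.exists_forall_le' (a := 0) hcont.continuousOn (by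
    rintro y ⟨⟨hy0, hy1⟩, hyI⟩
    have hne : y ≠ 0 := by
      rintro rfl
      simp at hy1
    obtain ⟨i, hi, hi'⟩ := hR.exists_pos_of_ne_zero hy0 hne
    have hiI : i ∈ I := by
      by_contra h
      exact hi.ne' (hyI i h)
    exact (Finset.lt_sup'_iff hI).2 ⟨i, hiI, hi'⟩)
  refine ⟨ε, hε, fun y b hy0 hyI hb hyb => ?_⟩
  rcases (Finset.sum_nonneg fun j _ => hy0 j : 0 ≤ ∑ j, y j).eq_or_lt with h0 | hpos
  · rwa [← h0, mul_zero]
  set σ := ∑ j, y j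
  have hmem : σ⁻¹ • y ∈ {y ∈ stdSimplex ℝ (Fin J) | ∀ j ∉ I, y j = 0} := by
    refine ⟨⟨fun j => mul_nonneg (inv_nonneg.2 hpos.le) (hy0 j), ?_⟩,
      fun j hj => by simp [hyI j hj]⟩
    simp only [Pi.smul_apply, smul_eq_mul, ← Finset.mul_sum]
    exact inv_mul_cancel₀ hpos.ne'
  obtain ⟨i, hi, hle⟩ := (Finset.le_sup'_iff hI).1 (hmin _ hmem)
  rw [Matrix.mulVec_smul, Pi.smul_apply, smul_eq_mul, ← div_eq_inv_mul, le_div_iff₀ hpos] at hle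
  exact hle.trans (hyb i hi)

/-! ### Lipschitz bounds for solutions -/

/-- The sum of the absolute values of the entries of `R`. -/
noncomputable def entrySum (R : Matrix (Fin J) (Fin J) ℝ) : ℝ := ∑ i, ∑ j, |R i j|

theorem entrySum_nonneg (R : Matrix (Fin J) (Fin J) ℝ) : 0 ≤ entrySum R :=
  Finset.sum_nonneg fun _ _ => Finset.sum_nonneg fun _ _ => abs_nonneg _

theorem abs_mulVec_le (R : Matrix (Fin J) (Fin J) ℝ) (y : Fin J → ℝ) (i : Fin J) :
    |R.mulVec y i| ≤ entrySum R * ∑ j, |y j| := by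
  have h1 : ∀ j, |R i j| ≤ entrySum R := fun j =>
    (Finset.single_le_sum (f := fun j => |R i j|) (fun _ _ => abs_nonneg _)
      (Finset.mem_univ j)).trans
    (Finset.single_le_sum (f := fun i => ∑ j, |R i j|)
      (fun _ _ => Finset.sum_nonneg fun _ _ => abs_nonneg _) (Finset.mem_univ i))
  rw [Finset.mul_sum, Matrix.mulVec, dotProduct]
  refine (Finset.abs_sum_le_sum_abs _ _).trans (Finset.sum_le_sum fun j _ => ?_)
  rw [abs_mul]
  exact mul_le_mul_of_nonneg_right (h1 j) (abs_nonneg _)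

theorem abs_le_sum_abs (θ : Fin J → ℝ) (i : Fin J) : |θ i| ≤ ∑ j, |θ j| :=
  Finset.single_le_sum (f := fun j => |θ j|) (fun _ _ => abs_nonneg _) (Finset.mem_univ i)

namespace IsSolution

variable {Z₀ : Fin J → ℝ≥0} {Z Y : FluidPath J}

theorem sub_eq (h : IsSolution θ R Z₀ Z Y) (s t : ℝ≥0) (i : Fin J) :
    (Z t i : ℝ) - Z s i = θ i * (t - s) + R.mulVec (fun j => (Y t j : ℝ) - Y s j) i := by
  have h1 : (fun j => (Y t j : ℝ) - Y s j) = (fun j => (Y t j : ℝ)) - fun j => (Y s j : ℝ) := rfl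
  rw [h.equation t, h.equation s, h1, Matrix.mulVec_sub, Pi.sub_apply]
  ring

theorem increment_nonneg (h : IsSolution θ R Z₀ Z Y) {s t : ℝ≥0} (hst : s ≤ t) (j : Fin J) :
    0 ≤ (Y t j : ℝ) - Y s j :=
  sub_nonneg.2 (NNReal.coe_le_coe.2 (h.mono_Y hst j))

theorem abs_sub_le (h : IsSolution θ R Z₀ Z Y) {s t : ℝ≥0} (hst : s ≤ t) (i : Fin J) :
    |(Z t i : ℝ) - Z s i| ≤
      (∑ j, |θ j|) * (t - s) + entrySum R * ∑ j, ((Y t j : ℝ) - Y s j) := by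
  have hst' : (0 : ℝ) ≤ t - s := sub_nonneg.2 hst
  rw [h.sub_eq]
  refine (abs_add_le _ _).trans (add_le_add ?_ ?_)
  · rw [abs_mul, abs_of_nonneg hst']
    exact mul_le_mul_of_nonneg_right (abs_le_sum_abs θ i) hst'
  · refine (abs_mulVec_le _ _ _).trans (le_of_eq ?_)
    simp only [abs_of_nonneg (h.increment_nonneg hst _)]

end IsSolution

/-- The increments of `Y` over an interval on which only the components in `I` increase are bounded
by a multiple of its length. If a component `j ∈ I` of `Z` does not vanish on the interval,
`I` can be replaced by `I \ {j}`. Otherwise the same replacement on the interval after the last zero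
bounds every `Z_j`, `j ∈ I`, at the right end point, hence `R ΔY` on `I`, and strict
semimonotonicity bounds `ΔY`. -/
theorem exists_sum_increment_le (hR : IsCompletelyS R) (I : Finset (Fin J)) :
    ∃ C : ℝ, 0 ≤ C ∧ ∀ (Z₀ : Fin J → ℝ≥0) (Z Y : FluidPath J), IsSolution θ R Z₀ Z Y →
      ∀ s t : ℝ≥0, s ≤ t → (∀ j ∉ I, Y s j = Y t j) →
        ∑ j, ((Y t j : ℝ) - Y s j) ≤ C * (t - s) := by
  induction I using Finset.strongInduction with
  | _ I ih =>
    have hex : ∀ k : Fin J, ∃ C : ℝ, 0 ≤ C ∧ (k ∈ I → ∀ (Z₀ : Fin J → ℝ≥0) (Z Y : FluidPath J),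
        IsSolution θ R Z₀ Z Y → ∀ s t : ℝ≥0, s ≤ t → (∀ j ∉ I.erase k, Y s j = Y t j) →
          ∑ j, ((Y t j : ℝ) - Y s j) ≤ C * (t - s)) := by
      intro k
      by_cases hk : k ∈ I
      · obtain ⟨C, hC, H⟩ := ih _ (Finset.erase_ssubset hk)
        exact ⟨C, hC, fun _ => H⟩
      · exact ⟨0, le_rfl, fun h => absurd h hk⟩
    choose C hC H using hex
    obtain ⟨ε, hε, hsemi⟩ := hR.exists_mul_sum_le I
    set C' := ∑ k, C k
    have hC' : 0 ≤ C' := Finset.sum_nonneg fun k _ => hC k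
    have hCC' : ∀ k, C k ≤ C' := fun k =>
      Finset.single_le_sum (f := C) (fun k _ => hC k) (Finset.mem_univ k)
    set Θ := ∑ j, |θ j|
    have hΘ : 0 ≤ Θ := Finset.sum_nonneg fun _ _ => abs_nonneg _
    have hρ := entrySum_nonneg R
    set N := Θ + entrySum R * C'
    have hN : 0 ≤ N := by positivity
    refine ⟨C' + (N + Θ) / ε, by positivity, fun Z₀ Z Y h s t hst hI => ?_⟩
    have hst' : (0 : ℝ) ≤ t - s := sub_nonneg.2 hst
    -- The bound with one index removed, on a subinterval `[v, t]` where `Z_k` is positive.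
    have hred : ∀ k ∈ I, ∀ v, s ≤ v → v ≤ t → (∀ u, v < u → u < t → 0 < Z u k) →
        ∑ j, ((Y t j : ℝ) - Y v j) ≤ C' * (t - v) := by
      intro k hk v hsv hvt hpos
      refine (H k hk Z₀ Z Y h v t hvt fun j hj => ?_).trans
        (mul_le_mul_of_nonneg_right (hCC' k) (sub_nonneg.2 hvt))
      by_cases hjI : j ∈ I
      · have hjk : j = k := by
          by_contra hne
          exact hj (Finset.mem_erase.2 ⟨hne, hjI⟩)
        rw [hjk]
        exact h.apply_eq_of_pos hvt hpos
      · exact le_antisymm (h.mono_Y hvt j) ((hI j hjI).ge.trans (h.mono_Y hsv j))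
    by_cases hzero : ∃ k ∈ I, ∀ u, s < u → u < t → 0 < Z u k
    · obtain ⟨k, hk, hpos⟩ := hzero
      refine (hred k hk s le_rfl hst hpos).trans (mul_le_mul_of_nonneg_right ?_ hst')
      exact le_add_of_nonneg_right (by positivity)
    · push Not at hzero
      have hZt : ∀ k ∈ I, (Z t k : ℝ) ≤ N * (t - s) := by
        intro k hk
        obtain ⟨u, hsu, hut, hu⟩ := hzero k hk
        have hcomp : IsCompact (Icc s t ∩ {v | Z v k = 0}) :=
          isCompact_Icc.inter_right
            (isClosed_eq ((continuous_apply k).comp h.continuous_Z) continuous_const)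
        obtain ⟨v, ⟨⟨hsv, hvt⟩, hv⟩, hmax⟩ := hcomp.exists_isGreatest
          ⟨u, ⟨hsu.le, hut.le⟩, le_antisymm hu zero_le⟩
        have hpos : ∀ u, v < u → u < t → 0 < Z u k := fun u hvu hut => by
          by_contra hu0
          exact hvu.not_ge (hmax ⟨⟨hsv.trans hvu.le, hut.le⟩,
            le_antisymm (not_lt.1 hu0) zero_le⟩)
        have h1 := (abs_le.1 (h.abs_sub_le hvt k)).2
        have h2 := mul_le_mul_of_nonneg_left (hred k hk v hsv hvt hpos) hρ
        have hv' : (Z v k : ℝ) = 0 := by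
          rw [show Z v k = 0 from hv, NNReal.coe_zero]
        have h3 : (t : ℝ) - v ≤ t - s := sub_le_sub_left (NNReal.coe_le_coe.2 hsv) _
        have h4 : N * ((t : ℝ) - v) ≤ N * (t - s) := mul_le_mul_of_nonneg_left h3 hN
        have h5 : N * ((t : ℝ) - v) = Θ * (t - v) + entrySum R * (C' * (t - v)) := by
          simp only [N]; ring
        linarith
      have hmain := hsemi (fun j => (Y t j : ℝ) - Y s j) ((N + Θ) * (t - s))
        (fun j => h.increment_nonneg hst j) (fun j hj => by rw [hI j hj, sub_self])
        (by positivity) fun i hi => by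
          have h1 := h.sub_eq s t i
          have h2 : -(Θ * (t - s)) ≤ θ i * (t - s) := by
            rw [← neg_mul]
            exact mul_le_mul_of_nonneg_right (neg_le_of_abs_le (abs_le_sum_abs θ i)) hst'
          have h3 : (0 : ℝ) ≤ Z s i := NNReal.coe_nonneg _
          linarith [hZt i hi]
      rw [mul_comm, ← le_div_iff₀ hε] at hmain
      refine hmain.trans ?_
      rw [mul_div_right_comm]
      exact mul_le_mul_of_nonneg_right (le_add_of_nonneg_left hC') hst'

/-- The regulators `Y` of all solutions have a common Lipschitz constant. -/
theorem exists_lipschitz_Y (hR : IsCompletelyS R) :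
    ∃ C : ℝ≥0, ∀ (Z₀ : Fin J → ℝ≥0) (Z Y : FluidPath J), IsSolution θ R Z₀ Z Y →
      ∀ s t : ℝ≥0, s ≤ t → ∑ j, ((Y t j : ℝ) - Y s j) ≤ C * (t - s) := by
  obtain ⟨C, hC, H⟩ := exists_sum_increment_le (θ := θ) hR Finset.univ
  exact ⟨⟨C, hC⟩, fun Z₀ Z Y h s t hst =>
    H Z₀ Z Y h s t hst fun j hj => absurd (Finset.mem_univ j) hj⟩

theorem exists_lipschitz_Z (hR : IsCompletelyS R) :
    ∃ L : ℝ, 0 < L ∧ ∀ Z ∈ solutionSet θ R, ∀ t s : ℝ≥0,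
      dist1 (Z t) (Z s) ≤ L * |(t : ℝ) - (s : ℝ)| := by
  obtain ⟨C, hC⟩ := exists_lipschitz_Y (θ := θ) hR
  have hΘ : 0 ≤ ∑ j, |θ j| := Finset.sum_nonneg fun _ _ => abs_nonneg _
  have hρ := entrySum_nonneg R
  refine ⟨J * ((∑ j, |θ j|) + entrySum R * C) + 1, by positivity, ?_⟩
  rintro Z ⟨Z₀, Y, h⟩
  have key : ∀ s t : ℝ≥0, s ≤ t → dist1 (Z t) (Z s) ≤
      (J * ((∑ j, |θ j|) + entrySum R * C) + 1) * |(t : ℝ) - (s : ℝ)| := by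
    intro s t hst
    have hst' : (0 : ℝ) ≤ t - s := sub_nonneg.2 hst
    rw [abs_of_nonneg hst']
    have h1 : ∀ i ∈ (Finset.univ : Finset (Fin J)), |(Z t i : ℝ) - Z s i| ≤
        ((∑ j, |θ j|) + entrySum R * C) * (t - s) := fun i _ => by
      have h2 := mul_le_mul_of_nonneg_left (hC Z₀ Z Y h s t hst) hρ
      linarith [h.abs_sub_le hst i]
    have h3 := Finset.sum_le_card_nsmul _ _ _ h1
    rw [Finset.card_univ, Fintype.card_fin, nsmul_eq_mul] at h3
    rw [dist1]
    linarith
  intro t s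
  rcases le_total s t with hst | hst
  · exact key s t hst
  · have h1 := key t s hst
    rw [abs_sub_comm]
    refine le_trans (le_of_eq ?_) h1
    exact Finset.sum_congr rfl fun i _ => abs_sub_comm _ _

/-! ### Shifts, scalings and concatenations of solutions -/

/-- The real-valued process `z + θ t + R Y(t)` generated by an initial state `z` and a
regulator `Y`; it is not required to be nonnegative. -/
noncomputable def netState (θ : Fin J → ℝ) (R : Matrix (Fin J) (Fin J) ℝ) (z : Fin J → ℝ≥0)
    (Y : FluidPath J) (t : ℝ≥0) (i : Fin J) : ℝ :=
  (z i : ℝ) + θ i * (t : ℝ) + R.mulVec (fun j => (Y t j : ℝ)) i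

theorem continuous_netState {Y : FluidPath J} (hY : Continuous Y) (z : Fin J → ℝ≥0) :
    Continuous (netState θ R z Y) := by
  refine continuous_pi fun i => ?_
  have h1 : Continuous fun t => R.mulVec (fun j => (Y t j : ℝ)) i :=
    (continuous_apply i).comp (Continuous.matrix_mulVec continuous_const
      (continuous_pi fun j => NNReal.continuous_coe.comp ((continuous_apply j).comp hY)))
  exact (continuous_const.add (continuous_const.mul NNReal.continuous_coe)).add h1

/-- A solution from a regulator with the pathwise complementarity condition. -/
theorem isSolution_of_forall {Z₀ : Fin J → ℝ≥0} {Z Y : FluidPath J} (hYc : Continuous Y)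
    (heq : ∀ t i, (Z t i : ℝ) = netState θ R Z₀ Y t i) (hY0 : Y 0 = 0) (hY : Monotone Y)
    (hcomp : ∀ (j : Fin J) (s t : ℝ≥0), s ≤ t → (∀ u ∈ Icc s t, 0 < Z u j) → Y s j = Y t j) :
    IsSolution θ R Z₀ Z Y := by
  have hZ : Continuous Z := by
    have h1 : Z = fun t i => (netState θ R Z₀ Y t i).toNNReal := by
      funext t i
      rw [← heq, Real.toNNReal_coe]
    rw [h1]
    exact continuous_pi fun i =>
      continuous_real_toNNReal.comp ((continuous_apply i).comp (continuous_netState hYc Z₀))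
  exact ⟨hZ, hYc, heq, hY0, hY, fun j => complementarity_of_forall hZ hYc hY j (hcomp j)⟩

namespace IsSolution

variable {Z₀ : Fin J → ℝ≥0} {Z Y : FluidPath J}

theorem apply_zero (h : IsSolution θ R Z₀ Z Y) : Z 0 = Z₀ := by
  funext i
  have h1 := h.equation 0 i
  have h2 : (fun j => (Y 0 j : ℝ)) = 0 := by
    funext j
    simp [h.zero_Y]
  rw [h2, Matrix.mulVec_zero] at h1
  exact_mod_cast (by simpa using h1 : (Z 0 i : ℝ) = Z₀ i)

theorem apply_eq_of_pos_Icc (h : IsSolution θ R Z₀ Z Y) (j : Fin J) (s t : ℝ≥0) (hst : s ≤ t)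
    (hpos : ∀ u ∈ Icc s t, 0 < Z u j) : Y s j = Y t j :=
  h.apply_eq_of_pos hst fun u hsu hut => hpos u ⟨hsu.le, hut.le⟩

theorem shift (h : IsSolution θ R Z₀ Z Y) (s : ℝ≥0) :
    IsSolution θ R (Z s) (fun t => Z (s + t)) (fun t j => Y (s + t) j - Y s j) := by
  refine isSolution_of_forall ?_ (fun t i => ?_) ?_ ?_ ?_
  · exact continuous_pi fun j =>
      ((continuous_apply j).comp (h.continuous_Y.comp (continuous_const.add continuous_id))).sub
        continuous_const
  · have h1 := h.sub_eq s (s + t) i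
    have h2 : (fun j => ((Y (s + t) j - Y s j : ℝ≥0) : ℝ)) =
        fun j => (Y (s + t) j : ℝ) - Y s j := by
      funext j
      exact NNReal.coe_sub (h.mono_Y le_self_add j)
    rw [netState, h2]
    rw [NNReal.coe_add, add_sub_cancel_left] at h1
    linarith
  · funext j
    simp
  · intro t u htu j
    exact tsub_le_tsub_right (h.mono_Y (add_le_add_right htu s) j) _
  · intro j t u htu hpos
    have h1 := h.apply_eq_of_pos_Icc j (s + t) (s + u) (add_le_add_right htu s) fun v hv => by
      obtain ⟨w, rfl⟩ := exists_add_of_le (le_self_add.trans hv.1)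
      exact hpos w ⟨le_of_add_le_add_left hv.1, le_of_add_le_add_left hv.2⟩
    simp only [h1]

theorem scaling (h : IsSolution θ R Z₀ Z Y) {r : ℝ≥0} (hr : 0 < r) :
    IsSolution θ R (fun i => r⁻¹ * Z₀ i) (fun t i => r⁻¹ * Z (r * t) i)
      (fun t j => r⁻¹ * Y (r * t) j) := by
  refine isSolution_of_forall ?_ (fun t i => ?_) ?_ ?_ ?_
  · exact continuous_pi fun j => continuous_const.mul
      ((continuous_apply j).comp (h.continuous_Y.comp (continuous_const.mul continuous_id)))
  · have h1 : (fun j => ((r⁻¹ * Y (r * t) j : ℝ≥0) : ℝ)) =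
        (r : ℝ)⁻¹ • fun j => (Y (r * t) j : ℝ) := by
      funext j
      simp
    have hr' : (r : ℝ) ≠ 0 := (NNReal.coe_pos.2 hr).ne'
    rw [netState, h1, Matrix.mulVec_smul, Pi.smul_apply, smul_eq_mul]
    push_cast
    rw [h.equation]
    push_cast
    field_simp
  · funext j
    simp [h.zero_Y]
  · intro t u htu j
    exact mul_le_mul_right (h.mono_Y (mul_le_mul_right htu r) j) _
  · intro j t u htu hpos
    rw [h.apply_eq_of_pos_Icc j (r * t) (r * u) (mul_le_mul_right htu r) fun v hv => ?_]
    have h1 := hpos (r⁻¹ * v) ⟨(le_inv_mul_iff₀ hr).2 hv.1, (inv_mul_le_iff₀ hr).2 hv.2⟩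
    rw [mul_inv_cancel_left₀ hr.ne'] at h1
    exact pos_of_mul_pos_right h1 zero_le

/-- The regulator of a concatenation stops the first regulator at `a` and adds the second one,
delayed by `a`; both operations use the truncation of `min` and of subtraction in `ℝ≥0`. -/
theorem concat {Z₀' : Fin J → ℝ≥0} {Z' Y' : FluidPath J} (h : IsSolution θ R Z₀ Z Y)
    (h' : IsSolution θ R Z₀' Z' Y') {a : ℝ≥0} (ha : Z a = Z' 0) :
    IsSolution θ R Z₀ (concat Z Z' a) (fun t => Y (min t a) + Y' (t - a)) := by
  have hY_le : ∀ t, t ≤ a → Y (min t a) + Y' (t - a) = Y t := fun t ht => by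
    rw [min_eq_left ht, tsub_eq_zero_of_le ht, h'.zero_Y, add_zero]
  have hY_ge : ∀ t, a ≤ t → Y (min t a) + Y' (t - a) = Y a + Y' (t - a) := fun t ht => by
    rw [min_eq_right ht]
  have hZ_ge : ∀ t, a ≤ t → GFN.concat Z Z' a t = Z' (t - a) := fun t ht => by
    rw [GFN.concat]
    split_ifs with hta
    · rw [le_antisymm hta ht, ha, tsub_self]
    · rfl
  refine isSolution_of_forall ?_ (fun t i => ?_) ?_ ?_ ?_
  · exact (h.continuous_Y.comp (continuous_id.min continuous_const)).add
      (h'.continuous_Y.comp (continuous_id.sub continuous_const))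
  · rcases le_total t a with hta | hta
    · rw [netState, hY_le t hta, GFN.concat, if_pos hta]
      exact h.equation t i
    · rw [netState, hY_ge t hta, hZ_ge t hta]
      have h1 : (fun j => (((Y a + Y' (t - a)) j : ℝ≥0) : ℝ)) =
          (fun j => (Y a j : ℝ)) + fun j => (Y' (t - a) j : ℝ) := by
        funext j
        simp
      have h2 := h'.equation (t - a) i
      have h3 := h.equation a i
      rw [ha, h'.apply_zero] at h3
      rw [h1, Matrix.mulVec_add, Pi.add_apply, h2, h3, NNReal.coe_sub hta]
      ring
  · exact (hY_le 0 zero_le).trans h.zero_Y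
  · intro t u htu
    exact add_le_add (h.mono_Y (min_le_min_right a htu)) (h'.mono_Y (tsub_le_tsub_right htu a))
  · have hfirst : ∀ (j : Fin J) (s t : ℝ≥0), s ≤ t → t ≤ a →
        (∀ u ∈ Icc s t, 0 < GFN.concat Z Z' a u j) → Y s j = Y t j := by
      intro j s t hst hta hpos
      refine h.apply_eq_of_pos_Icc j s t hst fun u hu => ?_
      have h1 := hpos u hu
      rwa [GFN.concat, if_pos (hu.2.trans hta)] at h1
    have hsecond : ∀ (j : Fin J) (s t : ℝ≥0), s ≤ t → a ≤ s →
        (∀ u ∈ Icc s t, 0 < GFN.concat Z Z' a u j) → Y' (s - a) j = Y' (t - a) j := by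
      intro j s t hst has hpos
      refine h'.apply_eq_of_pos_Icc j _ _ (tsub_le_tsub_right hst a) fun u hu => ?_
      have h1 := hpos (u + a) ⟨tsub_le_iff_right.1 hu.1,
        (add_le_add_left hu.2 a).trans (tsub_add_cancel_of_le (has.trans hst)).le⟩
      rwa [hZ_ge _ le_add_self, add_tsub_cancel_right] at h1
    intro j s t hst hpos
    rcases le_total t a with hta | hta
    · rw [hY_le t hta, hY_le s (hst.trans hta)]
      exact hfirst j s t hst hta hpos
    · rcases le_total s a with hsa | has
      · have h1 := hfirst j s a hsa le_rfl fun u hu => hpos u ⟨hu.1, hu.2.trans hta⟩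
        have h2 := hsecond j a t hta le_rfl fun u hu => hpos u ⟨hsa.trans hu.1, hu.2⟩
        rw [tsub_self, h'.zero_Y] at h2
        rw [hY_le s hsa, hY_ge t hta, Pi.add_apply, h1, ← h2, Pi.zero_apply, add_zero]
      · rw [hY_ge s has, hY_ge t hta, Pi.add_apply, Pi.add_apply, hsecond j s t hst has hpos]

end IsSolution

/-! ### Limits of approximate solutions -/

theorem abs_netState_sub_le (z z' : Fin J → ℝ≥0) (Y Y' : FluidPath J) (t : ℝ≥0) (i : Fin J) :
    |netState θ R z Y t i - netState θ R z' Y' t i| ≤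
      dist1 z z' + entrySum R * dist1 (Y t) (Y' t) := by
  have h1 : netState θ R z Y t i - netState θ R z' Y' t i = ((z i : ℝ) - z' i) +
      R.mulVec (fun j => (Y t j : ℝ) - Y' t j) i := by
    have h2 : (fun j => (Y t j : ℝ) - Y' t j) = (fun j => (Y t j : ℝ)) - fun j => (Y' t j : ℝ) :=
      rfl
    rw [h2, Matrix.mulVec_sub, Pi.sub_apply, netState, netState]
    ring
  rw [h1]
  exact (abs_add_le _ _).trans (add_le_add
    (Finset.single_le_sum (f := fun i => |(z i : ℝ) - z' i|) (fun _ _ => abs_nonneg _)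
      (Finset.mem_univ i)) (abs_mulVec_le _ _ _))

/-- Regulators with a common Lipschitz constant, which are in the limit nonnegative and
complementary in the sense that a component stays constant while the state is not small, have a
subsequence converging to a solution. -/
theorem exists_solution_of_approx {C : ℝ≥0} {zn : ℕ → Fin J → ℝ≥0} {Z₀ : Fin J → ℝ≥0}
    {Yn : ℕ → FluidPath J} (hz : Tendsto zn atTop (𝓝 Z₀)) (hlip : ∀ n, LipschitzWith C (Yn n))
    (hY0 : ∀ n, Yn n 0 = 0) (hY : ∀ n, Monotone (Yn n))
    (hnonneg : ∀ t i, ∀ᶠ n in atTop, 0 ≤ netState θ R (zn n) (Yn n) t i)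
    (hcomp : ∀ (j : Fin J) (δ : ℝ), 0 < δ → ∀ s t : ℝ≥0, s ≤ t → ∀ᶠ n in atTop,
      (∀ u ∈ Icc s t, δ ≤ netState θ R (zn n) (Yn n) u j) → Yn n s j = Yn n t j) :
    ∃ (Z Y : FluidPath J) (φ : ℕ → ℕ), StrictMono φ ∧ IsSolution θ R Z₀ Z Y ∧
      ∀ t i, Tendsto (fun n => netState θ R (zn (φ n)) (Yn (φ n)) t i) atTop (𝓝 (Z t i : ℝ)) := by
  obtain ⟨Y, φ, hφ, hYlip, hlim⟩ := exists_subseq_tendstoUOC hlip (B := 0) fun n => by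
    rw [hY0, norm1_eq_zero.2 rfl, NNReal.coe_zero]
  have hρ := entrySum_nonneg R
  have hclose : ∀ (T : ℝ≥0) (ε : ℝ), 0 < ε → ∀ᶠ n in atTop, ∀ t ≤ T, ∀ i,
      |netState θ R (zn (φ n)) (Yn (φ n)) t i - netState θ R Z₀ Y t i| ≤ ε := by
    intro T ε hε
    obtain ⟨N, hN⟩ := hlim T (ε / (2 * (entrySum R + 1))) (by positivity)
    have hz0 : Tendsto (fun n => dist1 (zn (φ n)) Z₀) atTop (𝓝 0) := by
      have h1 : Continuous fun z : Fin J → ℝ≥0 => dist1 z Z₀ := by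
        unfold dist1
        fun_prop
      have h2 := (h1.tendsto Z₀).comp (hz.comp hφ.tendsto_atTop)
      rwa [dist1_self] at h2
    filter_upwards [hz0.eventually_le_const (half_pos hε), eventually_ge_atTop N]
      with n hn1 hn2 t ht i
    refine (abs_netState_sub_le _ _ _ _ _ _).trans ?_
    have h1 : entrySum R * dist1 (Yn (φ n) t) (Y t) ≤ ε / 2 :=
      calc entrySum R * dist1 (Yn (φ n) t) (Y t)
          ≤ (entrySum R + 1) * (ε / (2 * (entrySum R + 1))) :=
            mul_le_mul (by linarith) (hN n hn2 t ht) (dist1_nonneg _ _) (by positivity)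
        _ = ε / 2 := by field_simp
    linarith
  have hstate : ∀ t i, Tendsto (fun n => netState θ R (zn (φ n)) (Yn (φ n)) t i) atTop
      (𝓝 (netState θ R Z₀ Y t i)) := fun t i => by
    rw [Metric.tendsto_nhds]
    intro ε hε
    filter_upwards [hclose t (ε / 2) (half_pos hε)] with n hn
    exact (hn t le_rfl i).trans_lt (half_lt_self hε)
  have hpos : ∀ t i, 0 ≤ netState θ R Z₀ Y t i := fun t i =>
    ge_of_tendsto (hstate t i) (hφ.tendsto_atTop.eventually (hnonneg t i))
  have hZ : ∀ t i, (((netState θ R Z₀ Y t i).toNNReal : ℝ≥0) : ℝ) = netState θ R Z₀ Y t i :=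
    fun t i => Real.coe_toNNReal _ (hpos t i)
  refine ⟨fun t i => (netState θ R Z₀ Y t i).toNNReal, Y, φ, hφ,
    isSolution_of_forall hYlip.continuous hZ ?_ ?_ ?_, fun t i => by rw [hZ]; exact hstate t i⟩
  · refine tendsto_nhds_unique (hlim.tendsto 0) ?_
    simp only [Function.comp_def, hY0]
    exact tendsto_const_nhds
  · intro s t hst
    exact le_of_tendsto_of_tendsto' (hlim.tendsto s) (hlim.tendsto t) fun n => hY _ hst
  · intro j s t hst hposZ
    -- On a compact interval a positive component is bounded away from `0`.
    obtain ⟨u₀, hu₀, hmin⟩ := (isCompact_Icc (a := s) (b := t)).exists_isMinOn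
      ⟨s, le_rfl, hst⟩ (f := fun u => netState θ R Z₀ Y u j)
      ((continuous_apply j).comp (continuous_netState hYlip.continuous Z₀)).continuousOn
    have hδ : 0 < netState θ R Z₀ Y u₀ j := Real.toNNReal_pos.1 (hposZ u₀ hu₀)
    refine tendsto_nhds_unique ((tendsto_pi_nhds.1 (hlim.tendsto s)) j)
      (((tendsto_pi_nhds.1 (hlim.tendsto t)) j).congr' ?_)
    filter_upwards [hclose t _ (half_pos hδ),
      hφ.tendsto_atTop.eventually (hcomp j _ (half_pos hδ) s t hst)] with n hn1 hn2
    refine (hn2 fun u hu => ?_).symm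
    have h1 := (abs_le.1 (hn1 u hu.2 j)).1
    have h2 : netState θ R Z₀ Y u₀ j ≤ netState θ R Z₀ Y u j := hmin hu
    linarith

/-- The set of solutions is closed under uniform convergence on compact sets. -/
theorem solutionSet_closed (hR : IsCompletelyS R) (Qn : ℕ → FluidPath J) (Q : FluidPath J)
    (hQn : ∀ n, Qn n ∈ solutionSet θ R) (hlim : TendstoUOC Qn Q) : Q ∈ solutionSet θ R := by
  obtain ⟨C, hC⟩ := exists_lipschitz_Y (θ := θ) hR
  choose zn Yn hsol using hQn
  have hstate : ∀ n t i, netState θ R (zn n) (Yn n) t i = Qn n t i := fun n t i =>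
    ((hsol n).equation t i).symm
  have hlip : ∀ n, LipschitzWith C (Yn n) := fun n => by
    have key : ∀ s t, s ≤ t → dist (Yn n t) (Yn n s) ≤ C * dist t s := fun s t hst => by
      refine (dist_le_dist1 _ _).trans ?_
      rw [NNReal.dist_eq, abs_of_nonneg (sub_nonneg.2 (NNReal.coe_le_coe.2 hst))]
      refine le_trans (le_of_eq ?_) (hC _ _ _ (hsol n) s t hst)
      exact Finset.sum_congr rfl fun j _ => abs_of_nonneg ((hsol n).increment_nonneg hst j)
    refine LipschitzWith.of_dist_le_mul fun t s => ?_
    rcases le_total s t with hst | hst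
    · exact key s t hst
    · rw [dist_comm, dist_comm t]
      exact key t s hst
  obtain ⟨Z, Y, φ, hφ, hZ, hconv⟩ := exists_solution_of_approx (θ := θ) (R := R) (zn := zn)
    (Z₀ := Q 0) (by simpa only [(hsol _).apply_zero] using hlim.tendsto 0) hlip
    (fun n => (hsol n).zero_Y) (fun n => (hsol n).mono_Y)
    (fun t i => Eventually.of_forall fun n => by rw [hstate]; exact NNReal.coe_nonneg _)
    (fun j δ hδ s t hst => Eventually.of_forall fun n hn =>
      (hsol n).apply_eq_of_pos_Icc j s t hst fun u hu => by
        have h1 := hn u hu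
        rw [hstate] at h1
        exact NNReal.coe_pos.1 (hδ.trans_le h1))
  have hQZ : Q = Z := by
    funext t i
    refine NNReal.coe_injective (tendsto_nhds_unique
      ((hlim.tendsto_coord t i).comp hφ.tendsto_atTop) ?_)
    simpa only [hstate, Function.comp_def] using hconv t i
  exact ⟨Q 0, Y, hQZ ▸ hZ⟩

/-! ### Existence of solutions -/

/-- On every face there is a rate of regulation that makes the drift nonnegative there. -/
theorem IsCompletelyS.exists_rate (hR : IsCompletelyS R) (θ : Fin J → ℝ) (I : Finset (Fin J)) :
    ∃ y : Fin J → ℝ≥0, (∀ j ∉ I, y j = 0) ∧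
      ∀ i ∈ I, 0 ≤ θ i + R.mulVec (fun j => (y j : ℝ)) i := by
  obtain ⟨x, hx0, hxI, hx⟩ := hR.exists_mulVec_pos I
  -- Scale the `S`-vector so that it dominates the drift on every coordinate of the face.
  let c : ℝ := ∑ i, |θ i| / |R.mulVec x i|
  have hc : 0 ≤ c := Finset.sum_nonneg fun i _ => div_nonneg (abs_nonneg _) (abs_nonneg _)
  refine ⟨fun j => (c * x j).toNNReal, fun j hj => by simp [hxI j hj], fun i hi => ?_⟩
  have h1 : (fun j => (((c * x j).toNNReal : ℝ≥0) : ℝ)) = c • x :=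
    funext fun j => Real.coe_toNNReal _ (mul_nonneg hc (hx0 j))
  have h2 : |θ i| / |R.mulVec x i| ≤ c :=
    Finset.single_le_sum (f := fun i => |θ i| / |R.mulVec x i|)
      (fun i _ => div_nonneg (abs_nonneg _) (abs_nonneg _)) (Finset.mem_univ i)
  rw [abs_of_pos (hx i hi), div_le_iff₀ (hx i hi)] at h2
  rw [h1, Matrix.mulVec_smul, Pi.smul_apply, smul_eq_mul]
  linarith [neg_abs_le (θ i)]

/-- Following `Y` up to time `T` and regulating at the constant rate `y` afterwards; `t - T` is
the truncated difference. -/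
noncomputable def extendLinearly (Y : FluidPath J) (T : ℝ≥0) (y : Fin J → ℝ≥0) : FluidPath J :=
  fun t j => Y (min t T) j + (t - T) * y j

theorem extendLinearly_of_le {Y : FluidPath J} {T : ℝ≥0} {y : Fin J → ℝ≥0} {t : ℝ≥0} (ht : t ≤ T) :
    extendLinearly Y T y t = Y t := by
  funext j
  simp [extendLinearly, min_eq_left ht, tsub_eq_zero_of_le ht]

theorem extendLinearly_add (Y : FluidPath J) (T : ℝ≥0) (y : Fin J → ℝ≥0) (v : ℝ≥0) (j : Fin J) :
    extendLinearly Y T y (T + v) j = Y T j + v * y j := by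
  simp [extendLinearly]

theorem netState_extendLinearly_of_le {z : Fin J → ℝ≥0} {Y : FluidPath J} {T : ℝ≥0}
    {y : Fin J → ℝ≥0} {t : ℝ≥0} (ht : t ≤ T) :
    netState θ R z (extendLinearly Y T y) t = netState θ R z Y t := by
  funext i
  rw [netState, netState, extendLinearly_of_le ht]

theorem netState_extendLinearly_add (z : Fin J → ℝ≥0) (Y : FluidPath J) (T : ℝ≥0)
    (y : Fin J → ℝ≥0) (v : ℝ≥0) (i : Fin J) :
    netState θ R z (extendLinearly Y T y) (T + v) i =
      netState θ R z Y T i + v * (θ i + R.mulVec (fun j => (y j : ℝ)) i) := by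
  have h1 : (fun j => (extendLinearly Y T y (T + v) j : ℝ)) =
      (fun j => (Y T j : ℝ)) + (v : ℝ) • fun j => (y j : ℝ) := by
    funext j
    simp [extendLinearly_add]
  rw [netState, netState, h1, Matrix.mulVec_add, Matrix.mulVec_smul, Pi.add_apply, Pi.smul_apply,
    smul_eq_mul, NNReal.coe_add]
  ring

/-- All increments of the components of `Y` are nonnegative and grow at rate at most `C`. -/
def HasRateLE (C : ℝ≥0) (Y : FluidPath J) : Prop :=
  ∀ s u j, Y s j ≤ Y (s + u) j ∧ Y (s + u) j ≤ Y s j + C * u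

theorem HasRateLE.monotone {C : ℝ≥0} {Y : FluidPath J} (h : HasRateLE C Y) : Monotone Y := by
  intro s t hst j
  obtain ⟨u, rfl⟩ := exists_add_of_le hst
  exact (h s u j).1

theorem HasRateLE.lipschitzWith {C : ℝ≥0} {Y : FluidPath J} (h : HasRateLE C Y) :
    LipschitzWith C Y := by
  have key : ∀ s u, dist (Y (s + u)) (Y s) ≤ C * dist (s + u) s := fun s u => by
    refine (dist_pi_le_iff (by positivity)).2 fun j => ?_
    have h1 : (Y s j : ℝ) ≤ Y (s + u) j := NNReal.coe_le_coe.2 (h s u j).1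
    have h2 : (Y (s + u) j : ℝ) ≤ Y s j + C * u := by exact_mod_cast (h s u j).2
    rw [NNReal.dist_eq, NNReal.dist_eq, NNReal.coe_add, add_sub_cancel_left, NNReal.abs_eq,
      abs_of_nonneg (sub_nonneg.2 h1)]
    linarith
  refine LipschitzWith.of_dist_le_mul fun t s => ?_
  rcases le_total s t with hst | hst
  · obtain ⟨u, rfl⟩ := exists_add_of_le hst
    exact key s u
  · obtain ⟨u, rfl⟩ := exists_add_of_le hst
    rw [dist_comm, dist_comm t]
    exact key t u

theorem HasRateLE.extendLinearly {C : ℝ≥0} {Y : FluidPath J} (h : HasRateLE C Y) (T : ℝ≥0)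
    {y : Fin J → ℝ≥0} (hy : ∀ j, y j ≤ C) : HasRateLE C (extendLinearly Y T y) := by
  intro s u j
  rcases le_total (s + u) T with hT | hT
  · rw [extendLinearly_of_le hT, extendLinearly_of_le (le_self_add.trans hT)]
    exact h s u j
  · rcases le_total T s with hs | hs
    · obtain ⟨v, rfl⟩ := exists_add_of_le hs
      rw [add_assoc, extendLinearly_add, extendLinearly_add, add_mul, ← add_assoc]
      refine ⟨le_self_add, add_le_add_right ?_ _⟩
      rw [mul_comm]
      exact mul_le_mul_left (hy j) u
    · obtain ⟨v, rfl⟩ := exists_add_of_le hs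
      obtain ⟨w, rfl⟩ := exists_add_of_le (le_of_add_le_add_left hT)
      rw [← add_assoc, extendLinearly_add, extendLinearly_of_le hs]
      refine ⟨(h s v j).1.trans le_self_add, ?_⟩
      calc Y (s + v) j + w * y j ≤ (Y s j + C * v) + w * C :=
            add_le_add (h s v j).2 (mul_le_mul_right (hy j) w)
        _ = Y s j + C * (v + w) := by ring

/-- Approximate solutions up to any horizon, by an Euler scheme: on each time step the components
with level at most `δ` are regulated at a constant rate that does not push any of them down, and
the step is too short for the remaining components to become negative. -/
theorem IsCompletelyS.exists_euler (hR : IsCompletelyS R) (θ : Fin J → ℝ) (z : Fin J → ℝ≥0) :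
    ∃ C : ℝ≥0, ∀ (δ : ℝ), 0 < δ → ∀ T : ℝ≥0, ∃ Y : FluidPath J, Y 0 = 0 ∧ HasRateLE C Y ∧
      (∀ t ≤ T, ∀ i, 0 ≤ netState θ R z Y t i) ∧
      ∀ (j : Fin J) (s t : ℝ≥0), s ≤ t → t ≤ T →
        (∀ u ∈ Icc s t, 2 * δ < netState θ R z Y u j) → Y s j = Y t j := by
  choose y hyI hy using hR.exists_rate θ
  set C : ℝ≥0 := ∑ I, ∑ j, y I j
  have hyC : ∀ I j, y I j ≤ C := fun I j =>
    (Finset.single_le_sum (f := fun j => y I j) (fun _ _ => zero_le) (Finset.mem_univ j)).trans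
    (Finset.single_le_sum (f := fun I => ∑ j, y I j) (fun _ _ => zero_le) (Finset.mem_univ I))
  set M : ℝ := ∑ I, ∑ i, |θ i + R.mulVec (fun j => (y I j : ℝ)) i| + 1
  have hsum : 0 ≤ ∑ I, ∑ i, |θ i + R.mulVec (fun j => (y I j : ℝ)) i| :=
    Finset.sum_nonneg fun _ _ => Finset.sum_nonneg fun _ _ => abs_nonneg _
  have hM : 0 < M := by positivity
  have hdM : ∀ I i, |θ i + R.mulVec (fun j => (y I j : ℝ)) i| ≤ M := fun I i =>
    ((Finset.single_le_sum (f := fun i => |θ i + R.mulVec (fun j => (y I j : ℝ)) i|)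
      (fun _ _ => abs_nonneg _) (Finset.mem_univ i)).trans
    (Finset.single_le_sum (f := fun I => ∑ i, |θ i + R.mulVec (fun j => (y I j : ℝ)) i|)
      (fun _ _ => Finset.sum_nonneg fun _ _ => abs_nonneg _) (Finset.mem_univ I))).trans
    (le_add_of_nonneg_right zero_le_one)
  refine ⟨C, fun δ hδ T => ?_⟩
  set h : ℝ≥0 := (δ / M).toNNReal
  have hh : (h : ℝ) = δ / M := Real.coe_toNNReal _ (by positivity)
  have hh0 : 0 < h := Real.toNNReal_pos.2 (by positivity)
  have hhM : (h : ℝ) * M = δ := by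
    rw [hh]
    field_simp
  have hstep : ∀ k : ℕ, ∃ Y : FluidPath J, Y 0 = 0 ∧ HasRateLE C Y ∧
      (∀ t ≤ k * h, ∀ i, 0 ≤ netState θ R z Y t i) ∧
      ∀ (j : Fin J) (s t : ℝ≥0), s ≤ t → t ≤ k * h →
        (∀ u ∈ Icc s t, 2 * δ < netState θ R z Y u j) → Y s j = Y t j := by
    intro k
    induction k with
    | zero =>
      refine ⟨0, rfl, fun s u j => by simp, fun t ht i => ?_, fun j s t _ _ _ => rfl⟩
      have h1 : t = 0 := by simpa using ht
      have h2 : (fun j => ((0 : FluidPath J) t j : ℝ)) = 0 := rfl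
      rw [netState, h2, Matrix.mulVec_zero, h1]
      simp
    | succ k ih =>
      obtain ⟨Y, hY0, hYrate, hYnonneg, hYcomp⟩ := ih
      set S : ℝ≥0 := k * h
      set I : Finset (Fin J) := Finset.univ.filter fun i => netState θ R z Y S i ≤ δ
      have hS : ((k + 1 : ℕ) : ℝ≥0) * h = S + h := by
        push_cast
        ring
      have hdrift : ∀ v ≤ h, ∀ i,
          |(v : ℝ) * (θ i + R.mulVec (fun j => (y I j : ℝ)) i)| ≤ δ := fun v hv i => by
        rw [abs_mul, NNReal.abs_eq, ← hhM]
        exact mul_le_mul hv (hdM I i) (abs_nonneg _) h.2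
      refine ⟨extendLinearly Y S (y I), ?_, hYrate.extendLinearly S (hyC I), ?_, ?_⟩
      · rw [extendLinearly_of_le zero_le, hY0]
      · intro t ht i
        rcases le_total t S with htS | htS
        · rw [netState_extendLinearly_of_le htS]
          exact hYnonneg t htS i
        · obtain ⟨v, rfl⟩ := exists_add_of_le htS
          rw [hS, add_le_add_iff_left] at ht
          rw [netState_extendLinearly_add]
          by_cases hi : i ∈ I
          · exact add_nonneg (hYnonneg S le_rfl i) (mul_nonneg v.2 (hy I i hi))
          · have h1 : δ < netState θ R z Y S i := by simpa [I] using hi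
            linarith [(abs_le.1 (hdrift v ht i)).1]
      · have hfirst : ∀ (j : Fin J) (s t : ℝ≥0), s ≤ t → t ≤ S →
            (∀ u ∈ Icc s t, 2 * δ < netState θ R z (extendLinearly Y S (y I)) u j) →
            extendLinearly Y S (y I) s j = extendLinearly Y S (y I) t j := by
          intro j s t hst htS hbig
          rw [extendLinearly_of_le htS, extendLinearly_of_le (hst.trans htS)]
          refine hYcomp j s t hst htS fun u hu => ?_
          have h1 := hbig u hu
          rwa [netState_extendLinearly_of_le (hu.2.trans htS)] at h1
        have hsecond : ∀ (j : Fin J) (s t : ℝ≥0), s ≤ t → S ≤ s → t ≤ S + h →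
            (∀ u ∈ Icc s t, 2 * δ < netState θ R z (extendLinearly Y S (y I)) u j) →
            extendLinearly Y S (y I) s j = extendLinearly Y S (y I) t j := by
          intro j s t hst hSs ht hbig
          obtain ⟨v, rfl⟩ := exists_add_of_le hSs
          obtain ⟨w, rfl⟩ := exists_add_of_le (hSs.trans hst)
          have hvh : v ≤ h := le_of_add_le_add_left (hst.trans ht)
          have h1 := hbig (S + v) ⟨le_rfl, hst⟩
          rw [netState_extendLinearly_add] at h1
          have h2 := (abs_le.1 (hdrift v hvh j)).2
          have hj : j ∉ I := by
            simp only [I, Finset.mem_filter, Finset.mem_univ, true_and, not_le]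
            linarith
          simp [extendLinearly_add, hyI I j hj]
        intro j s t hst ht hbig
        rw [hS] at ht
        rcases le_total t S with htS | htS
        · exact hfirst j s t hst htS hbig
        · rcases le_total s S with hsS | hsS
          · exact (hfirst j s S hsS le_rfl fun u hu => hbig u ⟨hu.1, hu.2.trans htS⟩).trans
              (hsecond j S t htS le_rfl ht fun u hu => hbig u ⟨hsS.trans hu.1, hu.2⟩)
          · exact hsecond j s t hst hsS ht hbig
  obtain ⟨k, hk⟩ := exists_nat_ge (T / h)
  have hTk : T ≤ k * h := (div_le_iff₀ hh0).1 hk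
  obtain ⟨Y, hY0, hYrate, hYnonneg, hYcomp⟩ := hstep k
  exact ⟨Y, hY0, hYrate, fun t ht => hYnonneg t (ht.trans hTk),
    fun j s t hst ht => hYcomp j s t hst (ht.trans hTk)⟩

/-- For a completely-`S` matrix the linear Skorokhod problem has a solution from every initial
state: a limit of Euler schemes. -/
theorem IsCompletelyS.exists_isSolution (hR : IsCompletelyS R) (θ : Fin J → ℝ)
    (z : Fin J → ℝ≥0) : ∃ Z Y : FluidPath J, IsSolution θ R z Z Y := by
  obtain ⟨C, hC⟩ := hR.exists_euler θ z
  choose Yn hY0 hrate hnonneg hcomp using fun n : ℕ =>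
    hC (1 / ((n : ℝ) + 1)) Nat.one_div_pos_of_nat (n : ℝ≥0)
  have hlarge : ∀ t : ℝ≥0, ∀ᶠ n : ℕ in atTop, t ≤ n := fun t =>
    tendsto_natCast_atTop_atTop.eventually_ge_atTop t
  obtain ⟨Z, Y, -, -, hsol, -⟩ := exists_solution_of_approx (θ := θ) (R := R)
    (tendsto_const_nhds (x := z)) (fun n => (hrate n).lipschitzWith) hY0
    (fun n => (hrate n).monotone)
    (fun t i => (hlarge t).mono fun n hn => hnonneg n t hn i)
    (fun j δ hδ s t hst => by
      have hsmall : ∀ᶠ n : ℕ in atTop, 1 / ((n : ℝ) + 1) < δ / 2 :=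
        tendsto_one_div_add_atTop_nhds_zero_nat.eventually_lt_const (half_pos hδ)
      filter_upwards [hlarge t, hsmall] with n hn1 hn2 hbig
      exact hcomp n j s t hst hn1 fun u hu => by linarith [hbig u hu])
  exact ⟨Z, Y, hsol⟩

/-! ### The set of solutions as a GFN model -/

theorem isClosedGFN_solutionSet (hR : IsCompletelyS R) : IsClosedGFN (solutionSet θ R) where
  nonempty := by
    obtain ⟨Z, Y, h⟩ := hR.exists_isSolution θ 0
    exact ⟨Z, 0, Y, h⟩
  lipschitz := exists_lipschitz_Z hR
  scaling := by
    rintro Z ⟨Z₀, Y, h⟩ r hr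
    exact ⟨_, _, h.scaling hr⟩
  shift := by
    rintro Z ⟨Z₀, Y, h⟩ s
    exact ⟨_, _, h.shift s⟩
  closed := solutionSet_closed hR

theorem hasConcat_solutionSet : HasConcat (solutionSet θ R) := by
  rintro Z ⟨Z₀, Y, h⟩ Z' ⟨Z₀', Y', h'⟩ a ha
  exact ⟨_, _, h.concat h' ha⟩

theorem initialStates_solutionSet (hR : IsCompletelyS R) :
    initialStates (solutionSet θ R) = univ := by
  refine eq_univ_of_forall fun z => ?_
  obtain ⟨Z, Y, h⟩ := hR.exists_isSolution θ z
  exact ⟨Z, ⟨z, Y, h⟩, h.apply_zero⟩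

end LSP

theorem mainTheorem8 (J : ℕ) (θ : Fin J → ℝ) (R : Matrix (Fin J) (Fin J) ℝ)
    (hR : LSP.IsCompletelyS R) :
    GFN.IsClosedGFN (LSP.solutionSet θ R) ∧
    GFN.HasConcat (LSP.solutionSet θ R) ∧
    GFN.initialStates (LSP.solutionSet θ R) = Set.univ ∧
    (LSP.IsStable θ R ↔ GFN.AdmitsUSCLyapunov (LSP.solutionSet θ R)) ∧
    (GFN.IsStable (LSP.solutionSet θ R) ↔ GFN.AdmitsUSCLyapunov (LSP.solutionSet θ R)) := by
  have hcl := LSP.isClosedGFN_solutionSet (θ := θ) hR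
  have hcon := LSP.hasConcat_solutionSet (θ := θ) (R := R)
  have hattr : GFN.AdmitsUSCLyapunov (LSP.solutionSet θ R) →
      GFN.IsAttractive (LSP.solutionSet θ R) := fun ⟨_, hV, _⟩ => hV.isAttractive hcl.toIsGFN
  -- `LSP.IsStable θ R` is by definition attractivity of the set of solutions.
  exact ⟨hcl, hcon, LSP.initialStates_solutionSet hR,
    ⟨fun h => hcl.admitsUSCLyapunov hcon (hcl.isStable_of_isAttractive hcon h), hattr⟩,
    ⟨fun h => hcl.admitsUSCLyapunov hcon h, fun h => hcl.isStable_of_isAttractive hcon (hattr h)⟩⟩
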